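/- Let $E$ and $U$ be finite non-empty sets (states and actions), let $\mathbb P^a(x,\cdot)$, $a\in U$, $x\in E$, be transition probabilities on $E$, and let $c\colon E\times U\to\mathbb R$. A policy $\pi=(a_n)_{n\ge 0}$ chooses the action $a_n\in U$ as a function of the states $X_0,\dots,X_n$; $\Pi$ is the set of all policies, and $\mathbb P^\pi_x$ is the law on $E^{\mathbb N}$ of the controlled process with $X_0=x$, with expectation $\mathbb E^\pi_x$. Let $\Pi'$ be the set of functions $u\colon E\to U$, identified with the stationary Markov policies $a_n=u(X_n)$, and let $\Pi''$ be the set of Markov policies $(u_n)_{n\ge0}$, $u_n\colon E\to U$, $a_n=u_n(X_n)$, with $n$-step transition matrices $\mathbb P^{(\pi,n)}$. For $\gamma\in\mathbb R$ put $$J_\gamma(x,\pi)=\begin{cases}\liminf_{n\to\infty}\frac1n\frac1\gamma\ln\mathbb E^\pi_x\big[e^{\gamma\sum_{i=0}^{n-1}c(X_i,a_i)}\big],&\gamma\ne0,\\ \liminf_{n\to\infty}\frac1n\mathbb E^\pi_x\big[\sum_{i=0}^{n-1}c(X_i,a_i)\big],&\gamma=0,\end{cases}$$ $J^*_\gamma(x)=\sup_{\pi\in\Pi}J_\gamma(x,\pi)$,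 $\Pi^*_\gamma=\{u\in\Pi'\colon J_\gamma(x,u)=J^*_\gamma(x)\text{ for all }x\in E\}$ and $\Gamma(u)=\{\gamma\in\mathbb R\colon u\in\Pi^*_\gamma\}$. For $w\colon E\to\mathbb R$ put $R^a_\gamma w(x)=\frac1\gamma\ln\sum_{y}e^{\gamma w(y)}\mathbb P^a(x,y)$ if $\gamma\neq0$ and $R^a_0w(x)=\sum_y w(y)\mathbb P^a(x,y)$. The Poisson equation of $u\in\Pi'$ at $\gamma$ (multiplicative if $\gamma\ne0$, additive if $\gamma=0$) is $$w(x)=c(x,u(x))-\lambda+R^{u(x)}_\gamma w(x),\quad x\in E,$$ and the Bellman equation at $\gamma$ is $$w(x)=\max_{a\in U}\big[c(x,a)-\lambda+R^a_\gamma w(x)\big],\quad x\in E,$$ where in both cases a solution is a pair $(w,\lambda)$ with $w\colon E\to\mathbb R$, $\lambda\in\mathbb R$. Assume (A.1) $\displaystyle\sup_{x,x'\in E}\sup_{A\subseteq E}\sup_{a,a'\in U}|\mathbb P^a(x,A)-\mathbb P^{a'}(x',A)|<1$; (A.2) there is $N\in\mathbb N$ with $\displaystyle\sup_{x,x',y\in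 E}\sup_{\pi\in\Pi''}\frac{\mathbb P^{(\pi,N)}(x,y)}{\mathbb P^{(\pi,N)}(x',y)}<\infty$, where $\frac00:=1$ and $\frac{p}{0}:=\infty$ for $p>0$. Then the following hold. 1. For all $u\in\Pi'$ and $\gamma\in\mathbb R$ the Poisson equation has a solution $(w,\lambda)$, and the constant $\lambda=:\lambda^u(\gamma)$ is the same for all solutions. Likewise, for each $\gamma$ the Bellman equation has a solution, with a unique constant $\lambda=:\lambda(\gamma)$. 2. For every $u\in\Pi'$ the function $\gamma\mapsto\lambda^u(\gamma)$ is continuous, bounded, non-decreasing and real analytic on $\mathbb R$. 3. For every $\gamma\in\mathbb R$, $\max_{u\in\Pi'}\lambda^u(\gamma)=\lambda(\gamma)$, and $J^*_\gamma(x)=\lambda(\gamma)$ for all $x\in E$. 4. For every $\gamma\in\mathbb R$, every $u\in\Pi'$ that maximizes $v\mapsto\lambda^v(\gamma)$ over $\Pi'$ belongs to $\Pi^*_\gamma$. 5. For every $u\in\Pi'$ the set $\Gamma(u)$ is closed and is a countable (possibly empty) union of non-empty closed intervals (which may be unbounded or single points). 6. For every $u\in\Pi'$, $\lambda^u(\gamma)\nearrow\lambda^u(\infty)$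 as $\gamma\to\infty$ for some $\lambda^u(\infty)\in\mathbb R$; if $\max_{u\in\Pi'}\lambda^u(\infty)$ is attained at a unique $u^*\in\Pi'$, then there is $\gamma_\infty\in\mathbb R$ with $\Pi^*_\gamma=\{u^*\}$ for all $\gamma\ge\gamma_\infty$. Similarly, $\lambda^u(\gamma)\searrow\lambda^u(-\infty)$ as $\gamma\to-\infty$ for some $\lambda^u(-\infty)\in\mathbb R$; if $\max_{u\in\Pi'}\lambda^u(-\infty)$ is attained at a unique $u_*\in\Pi'$, then there is $\gamma_{-\infty}\in\mathbb R$ with $\Pi^*_\gamma=\{u_*\}$ for all $\gamma\le\gamma_{-\infty}$. -/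

import Mathlib

open MeasureTheory ProbabilityTheory Filter Topology

noncomputable section

/-- A Markov decision process with state space `E` and action space `U`: the transition
probabilities `trans a x y = p_a(x, y)` and the running reward `c`. -/
structure MDP (E U : Type*) where
  trans : U → E → PMF E
  reward : E → U → ℝ

namespace MDP

variable {E U : Type*}

/-! ### The ergodic assumptions -/

/-- The `n`-step transition law of the Markov policy `(v 0, v 1, …)`: in state `z` at time `i`
the action `v i z` is used. -/
def nStep (M : MDP E U) (v : ℕ → E → U) : ℕ → E → PMF E
  | 0, x => PMF.pure x
  | n + 1, x => (M.nStep v n x).bind fun z => M.trans (v n z) z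

/-- Quotient of probabilities with the conventions `0 / 0 = 1` and `a / 0 = ∞` for `a > 0`. -/
def ratio (a b : ENNReal) : ENNReal :=
  open Classical in if a = 0 ∧ b = 0 then 1 else a / b

/-- One-step mixing: the supremum of `|P^a(x, A) - P^{a'}(x', A)|` is smaller than one. -/
def OneStepMixing [MeasurableSpace E] (M : MDP E U) : Prop :=
  (⨆ (x : E) (x' : E) (A : Set E) (a : U) (a' : U),
    |(M.trans a x).toMeasure.real A - (M.trans a' x').toMeasure.real A|) < 1

/-- Multi-step transition equivalence, the supremum being over all Markov policies. -/
def TransitionEquivalence (M : MDP E U) : Prop :=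
  ∃ N : ℕ, (⨆ (x : E) (x' : E) (y : E) (v : ℕ → E → U),
    ratio (M.nStep v N x y) (M.nStep v N x' y)) < ⊤

/-! ### Policies, controlled processes and the optimality criterion -/

/-- A policy picks the action at time `n` from the states visited at times `0, …, n`. -/
def Policy (E U : Type*) : Type _ := ∀ n : ℕ, (Finset.Iic n → E) → U

/-- The policy that always uses the action `u z` in state `z`. -/
def stationary (u : E → U) : Policy E U :=
  fun n h => u (h ⟨n, Finset.mem_Iic.2 le_rfl⟩)

/-- The action used at time `n` along the trajectory `ω`. -/
def Policy.action (π : Policy E U) (n : ℕ) (ω : ℕ → E) : U := π n fun i => ω i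

section Controlled

variable [Finite E] [MeasurableSpace E] [DiscreteMeasurableSpace E]

/-- The law of the state at time `n + 1`, given the states at times `0, …, n`. -/
def stepKernel (M : MDP E U) (π : Policy E U) (n : ℕ) : Kernel (Finset.Iic n → E) E :=
  Kernel.ofFunOfCountable fun h =>
    (M.trans (π n h) (h ⟨n, Finset.mem_Iic.2 le_rfl⟩)).toMeasure

instance (M : MDP E U) (π : Policy E U) (n : ℕ) : IsMarkovKernel (M.stepKernel π n) :=
  ⟨fun h => inferInstanceAs (IsProbabilityMeasure
    (M.trans (π n h) (h ⟨n, Finset.mem_Iic.2 le_rfl⟩)).toMeasure)⟩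

/-- The law on the canonical space `E^ℕ` of the process controlled by `π` and started at `x`. -/
def law (M : MDP E U) (π : Policy E U) (x : E) : Measure (ℕ → E) :=
  Kernel.traj (X := fun _ => E) (M.stepKernel π) 0 fun _ => x

/-- Total reward collected at times `0, …, n - 1` along a trajectory. -/
def totalReward (M : MDP E U) (π : Policy E U) (n : ℕ) (ω : ℕ → E) : ℝ :=
  ∑ i ∈ Finset.range n, M.reward (ω i) (π.action i ω)

/-- Entropic utility with parameter `γ` of the total reward of the first `n` steps. -/
def entropicReward (M : MDP E U) (γ : ℝ) (x : E) (π : Policy E U) (n : ℕ) : ℝ :=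
  if γ = 0 then ∫ ω, M.totalReward π n ω ∂(M.law π x)
  else 1 / γ * Real.log (∫ ω, Real.exp (γ * M.totalReward π n ω) ∂(M.law π x))

/-- The long-run average risk-sensitive criterion `J_γ(x, π)`. -/
def criterion (M : MDP E U) (γ : ℝ) (x : E) (π : Policy E U) : EReal :=
  liminf (fun n : ℕ => ((1 / (n : ℝ) * M.entropicReward γ x π n : ℝ) : EReal)) atTop

/-- The optimal value `J*_γ(x)`, a supremum over all policies. -/
def optimalValue (M : MDP E U) (γ : ℝ) (x : E) : EReal :=
  ⨆ π : Policy E U, M.criterion γ x π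

/-- The set `Π*_γ` of the stationary Markov policies that are optimal, among all policies, for
every starting point. -/
def optimalPolicies (M : MDP E U) (γ : ℝ) : Set (E → U) :=
  {u | ∀ x, M.criterion γ x (stationary u) = M.optimalValue γ x}

/-- The set `Γ(u)` of the parameters for which `u` is optimal. -/
def optimalParams (M : MDP E U) (u : E → U) : Set ℝ :=
  {γ | u ∈ M.optimalPolicies γ}

end Controlled

/-! ### Poisson and Bellman equations -/

section Equations

variable [Fintype E]

/-- Entropic utility with parameter `γ` of `w` at the next state, from `x` under action `a`. -/
def nextUtility (M : MDP E U) (γ : ℝ) (w : E → ℝ) (x : E) (a : U) : ℝ :=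
  if γ = 0 then ∑ y, w y * (M.trans a x y).toReal
  else 1 / γ * Real.log (∑ y, Real.exp (γ * w y) * (M.trans a x y).toReal)

/-- `(w, l)` solves the multiplicative (`γ ≠ 0`) or additive (`γ = 0`) Poisson equation of the
stationary policy `u`. -/
def SolvesPoisson (M : MDP E U) (u : E → U) (γ : ℝ) (w : E → ℝ) (l : ℝ) : Prop :=
  ∀ x, w x = M.reward x (u x) - l + M.nextUtility γ w x (u x)

/-- `(w, l)` solves the averaged Bellman equation
`w(x) = max_a [c(x, a) - l + nextUtility γ w x a]`. -/
def SolvesBellman (M : MDP E U) (γ : ℝ) (w : E → ℝ) (l : ℝ) : Prop :=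
  ∀ x, IsGreatest (Set.range fun a => M.reward x a - l + M.nextUtility γ w x a) (w x)

end Equations

end MDP

end

/-! For each `γ` the Bellman operator is monotone and commutes with the addition of constants.
Comparing two additive eigenvectors at a point where their difference is largest orders their
eigenvalues. This one argument (`Topical.eigenvalue_le`) gives uniqueness of the constants, `λ^u ≤
λ`, monotonicity in `γ` (by Jensen the one-step utility increases with `γ`) and the bound by `sup
|c|`. Eigenvectors exist once the iterates of 0 have bounded oscillation
(`Topical.exists_eigenvector`). At `γ = 0` this comes from the span contraction given by (A.1); at
`γ ≠ 0` it comes from (A.2), since the `N`-step laws of a greedy policy are comparable and the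
rewards contribute only a bounded factor. The Poisson equation of `u` is the Bellman equation of a
process with a single action.

Solutions are linked to the criterion by the tower property: a terminal reward `w` shifts the
utility by at most `sup |w|`, which disappears after division by `n`. So `u` earns `λ^u(γ)`, the
optimal value is `λ(γ)`, and `u` is optimal exactly when `λ^u(γ)` is maximal.

For analyticity, `exp (γ λ^u(γ))` is the Perron eigenvalue of a tilted transition matrix. By (A.2)
it is simple, so the implicit function theorem applies (`IsPosEigen.exists_analyticAt`); dividing
its logarithm by `γ` leaves a removable singularity at 0. By the identity theorem two distinct
functions `λ^u` agree on a countable set only, which yields the intervals. The limits at `±∞` exist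
by monotonicity, and strict inequalities between them persist near infinity. -/

/-! ### Topical maps and their additive eigenvectors. -/

/-- A self-map of `E → ℝ` that is monotone and commutes with the addition of constants. -/
structure Topical {E : Type*} (T : (E → ℝ) → E → ℝ) : Prop where
  mono : Monotone T
  add_const : ∀ w k x, T (fun y => w y + k) x = T w x + k

namespace Topical

variable {E : Type*} {T T' : (E → ℝ) → E → ℝ}

theorem le_add_const (hT : Topical T) {v w : E → ℝ} {k : ℝ} (h : ∀ x, v x ≤ w x + k) (x : E) :
    T v x ≤ T w x + k := by
  rw [← hT.add_const]
  exact hT.mono h x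

theorem iterate (hT : Topical T) (n : ℕ) : Topical T^[n] := by
  induction n with
  | zero => exact ⟨monotone_id, fun _ _ _ => rfl⟩
  | succ n ih =>
    refine ⟨hT.mono.iterate _, fun w k x => ?_⟩
    rw [Function.iterate_succ_apply', Function.iterate_succ_apply', ← hT.add_const]
    congr 1
    exact funext fun y => ih.add_const w k y

theorem sub_const (hT : Topical T) (l : ℝ) : Topical fun w x => T w x - l :=
  ⟨fun _ _ h x => sub_le_sub_right (hT.mono h x) l, fun w k x => by
    simp only [hT.add_const]; ring⟩

theorem sub_const_iterate (hT : Topical T) (l : ℝ) (w : E → ℝ) (n : ℕ) :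
    (fun w x => T w x - l)^[n] w = fun x => T^[n] w x - n * l := by
  induction n with
  | zero => simp
  | succ n ih =>
    rw [Function.iterate_succ_apply', ih]
    funext x
    have := hT.add_const (T^[n] w) (-(n * l)) x
    simp only [← sub_eq_add_neg] at this
    rw [this, Function.iterate_succ_apply']
    push_cast
    ring

/-- Additive eigenvalues of comparable topical maps are comparable: a subsolution for `T` and a
supersolution for `T' ≥ T`. -/
theorem eigenvalue_le [Finite E] [Nonempty E] (hT : Topical T) {w w' : E → ℝ} {l l' : ℝ}
    (hw : ∀ x, w x + l ≤ T w x) (hw' : ∀ x, T w' x ≤ w' x + l') : l ≤ l' := by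
  obtain ⟨x, hx⟩ := Finite.exists_max fun x => w x - w' x
  have := hT.le_add_const (v := w) (w := w') (k := w x - w' x) (fun y => by linarith [hx y]) x
  linarith [hw x, hw' x]

variable [Fintype E]

theorem lipschitz (hT : Topical T) : LipschitzWith 1 T := by
  refine LipschitzWith.of_dist_le_mul fun v w => ?_
  rw [NNReal.coe_one, one_mul, dist_pi_le_iff dist_nonneg]
  intro x
  have key : ∀ v w : E → ℝ, T v x ≤ T w x + dist v w := fun v w =>
    hT.le_add_const (fun y => by
      have := (le_abs_self _).trans ((Real.dist_eq (v y) (w y)).symm.le.trans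
        (dist_le_pi_dist v w y))
      linarith) x
  rw [Real.dist_eq, abs_le]
  have := key w v
  rw [dist_comm] at this
  constructor <;> linarith [key v w]

/-- The pointwise limsup `p` of the orbit of 0 satisfies `p ≤ T p`, by monotonicity and continuity.
The iterates of `p` then increase, stay bounded and converge to a fixed point. -/
theorem exists_fixedPoint_of_bounded (hT : Topical T) {K : ℝ}
    (hK : ∀ n x, |T^[n] 0 x| ≤ K) : ∃ w, T w = w := by
  set z : ℕ → E → ℝ := fun n => T^[n] 0
  have hup : ∀ n x, z n x ≤ K := fun n x => (abs_le.1 (hK n x)).2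
  have hlo : ∀ n x, -K ≤ z n x := fun n x => (abs_le.1 (hK n x)).1
  have hbdd : ∀ n x, BddAbove (Set.range fun k => z (n + k) x) := fun n x =>
    ⟨K, by rintro _ ⟨k, rfl⟩; exact hup _ _⟩
  set s : ℕ → E → ℝ := fun n x => ⨆ k, z (n + k) x
  have hsz : ∀ n k x, z (n + k) x ≤ s n x := fun n k x => le_ciSup (hbdd n x) k
  have hs_anti : ∀ x, Antitone fun n => s n x := fun x => antitone_nat_of_succ_le fun n =>
    ciSup_le fun k => by
      have := hsz n (k + 1) x
      rwa [show n + (k + 1) = n + 1 + k by ring] at this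
  have hs_lo : ∀ x, BddBelow (Set.range fun n => s n x) := fun x =>
    ⟨-K, by rintro _ ⟨n, rfl⟩; exact (hlo _ _).trans (hsz n 0 x)⟩
  set p : E → ℝ := fun x => ⨅ n, s n x
  have hsp : Tendsto s atTop (𝓝 p) := tendsto_pi_nhds.2 fun x =>
    tendsto_atTop_ciInf (hs_anti x) (hs_lo x)
  have hsT : ∀ n, s (n + 1) ≤ T (s n) := fun n x => ciSup_le fun k => by
    have := hT.mono (fun y => hsz n k y) x
    have hz : T (z (n + k)) = z (n + 1 + k) := by
      rw [show n + 1 + k = n + k + 1 by ring]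
      exact (Function.iterate_succ_apply' _ _ _).symm
    rw [← hz]
    exact this
  have hpT : p ≤ T p := le_of_tendsto_of_tendsto' ((tendsto_add_atTop_iff_nat 1).2 hsp)
    ((hT.lipschitz.continuous.tendsto p).comp hsp) hsT
  have hpK : ∀ x, p x ≤ K := fun x =>
    (ciInf_le (hs_lo x) 0).trans (ciSup_le fun k => hup _ _)
  have hmono : Monotone fun n => T^[n] p := hT.mono.monotone_iterate_of_le_map hpT
  -- Since `p ≤ K`, the orbit of `p` lies at most `K` above that of 0; hence `K + K`.
  have hub : ∀ x, BddAbove (Set.range fun n => T^[n] p x) := fun x => ⟨K + K, by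
    rintro _ ⟨n, rfl⟩
    have := (hT.iterate n).le_add_const (v := p) (w := 0) (k := K)
      (fun y => by simpa using hpK y) x
    have := hup n x
    simp only [z] at this
    dsimp only
    linarith⟩
  have hlim : Tendsto (fun n => T^[n] p) atTop (𝓝 fun x => ⨆ n, T^[n] p x) :=
    tendsto_pi_nhds.2 fun x => tendsto_atTop_ciSup (fun _ _ h => hmono h x) (hub x)
  exact ⟨_, isFixedPt_of_tendsto_iterate hlim hT.lipschitz.continuous.continuousAt⟩

/-- A topical map whose orbits have bounded oscillation has an additive eigenvector. -/
theorem exists_eigenvector [Nonempty E] (hT : Topical T) {K : ℝ}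
    (hK : ∀ n x y, T^[n] 0 x - T^[n] 0 y ≤ K) : ∃ w l, ∀ x, T w x = w x + l := by
  -- Fekete's lemma applies to the maxima `a` and to minus the minima `b`. As `a n - b n ≤ K`, both
  -- have the same rate `l`, and `b n ≤ n * l ≤ a n` keeps the orbit of `T - l` within `K` of 0.
  set a : ℕ → ℝ := fun n => Finset.univ.sup' Finset.univ_nonempty (T^[n] 0)
  set b : ℕ → ℝ := fun n => Finset.univ.inf' Finset.univ_nonempty (T^[n] 0)
  have ha : ∀ n x, T^[n] 0 x ≤ a n := fun n x => Finset.le_sup' _ (Finset.mem_univ x)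
  have hb : ∀ n x, b n ≤ T^[n] 0 x := fun n x => Finset.inf'_le _ (Finset.mem_univ x)
  have hab : ∀ n, a n - b n ≤ K := fun n => by
    obtain ⟨x, -, hx⟩ := Finset.exists_mem_eq_sup' Finset.univ_nonempty (T^[n] 0)
    obtain ⟨y, -, hy⟩ := Finset.exists_mem_eq_inf' Finset.univ_nonempty (T^[n] 0)
    simp only [a, b, hx, hy]
    exact hK n x y
  have hba : ∀ n, b n ≤ a n := fun n =>
    (hb n (Classical.arbitrary E)).trans (ha n _)
  have hK0 : 0 ≤ K := by linarith [hab 0, hba 0]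
  have hasub : Subadditive a := fun m n => Finset.sup'_le _ _ fun x _ => by
    rw [Function.iterate_add_apply]
    have := (hT.iterate m).le_add_const (v := T^[n] 0) (w := 0) (k := a n)
      (fun y => by simpa using ha n y) x
    linarith [ha m x]
  have hbsub : Subadditive fun n => -b n := fun m n => by
    have : b m + b n ≤ b (m + n) := Finset.le_inf' _ _ fun x _ => by
      rw [Function.iterate_add_apply]
      have := (hT.iterate m).le_add_const (v := 0) (w := T^[n] 0) (k := -b n)
        (fun y => by have := hb n y; simp; linarith) x
      linarith [hb m x]
    linarith
  have ha0 : ∀ n : ℕ, n * b 1 ≤ b n := fun n => by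
    induction n with
    | zero => simp [b]
    | succ n ih => have := hbsub n 1; push_cast; linarith
  have hb0 : ∀ n : ℕ, a n ≤ n * a 1 := fun n => by
    induction n with
    | zero => simp [a]
    | succ n ih => have := hasub n 1; push_cast; linarith
  -- The `min 0` accounts for `n = 0`, where the quotient is 0 by convention.
  have hbda : BddBelow (Set.range fun n => a n / n) := ⟨min 0 (b 1), by
    rintro _ ⟨n, rfl⟩
    rcases n.eq_zero_or_pos with rfl | hn
    · simp
    · refine (min_le_right _ _).trans ((le_div_iff₀ (by positivity)).2 ?_)
      linarith [ha0 n, hba n]⟩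
  have hbdb : BddBelow (Set.range fun n => -b n / n) := ⟨min 0 (-a 1), by
    rintro _ ⟨n, rfl⟩
    rcases n.eq_zero_or_pos with rfl | hn
    · simp
    · refine (min_le_right _ _).trans ((le_div_iff₀ (by positivity)).2 ?_)
      linarith [hb0 n, hba n]⟩
  have hlim : hasub.lim + hbsub.lim = 0 := by
    refine tendsto_nhds_unique ((hasub.tendsto_lim hbda).add (hbsub.tendsto_lim hbdb)) ?_
    refine squeeze_zero (g := fun n : ℕ => K / n) (fun n => ?_) (fun n => ?_)
      (tendsto_const_div_atTop_nhds_zero_nat K)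
    · rw [← add_div]
      exact div_nonneg (by linarith [hba n]) n.cast_nonneg
    · rw [← add_div]
      exact div_le_div_of_nonneg_right (by linarith [hab n]) n.cast_nonneg
  set l := hasub.lim
  have hla : ∀ n : ℕ, n * l ≤ a n := fun n => by
    rcases n.eq_zero_or_pos with rfl | hn
    · simp [a]
    · have := hasub.lim_le_div hbda hn.ne'
      rwa [le_div_iff₀ (by positivity), mul_comm] at this
  have hlb : ∀ n : ℕ, b n ≤ n * l := fun n => by
    rcases n.eq_zero_or_pos with rfl | hn
    · simp [b]
    · have := hbsub.lim_le_div hbdb hn.ne'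
      rw [le_div_iff₀ (by positivity), show hbsub.lim = -l by linarith] at this
      linarith
  obtain ⟨w, hw⟩ := (hT.sub_const l).exists_fixedPoint_of_bounded (K := K) fun n x => by
    rw [hT.sub_const_iterate, abs_le]
    constructor <;> linarith [hab n, hla n, hlb n, ha n x, hb n x]
  exact ⟨w, l, fun x => by linarith [congrFun hw x]⟩

end Topical

/-! ### Averages against a probability vector. -/

namespace PMF

variable {E : Type*} [Fintype E]

theorem sum_toReal (p : PMF E) : ∑ y, (p y).toReal = 1 := by
  rw [← ENNReal.toReal_sum fun y _ => p.apply_ne_top y, ← tsum_fintype (L := .unconditional E),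
    p.tsum_coe, ENNReal.toReal_one]

theorem sum_mul_toReal_le (p : PMF E) {f g : E → ℝ} (h : ∀ y, f y ≤ g y) :
    ∑ y, f y * (p y).toReal ≤ ∑ y, g y * (p y).toReal :=
  Finset.sum_le_sum fun y _ => mul_le_mul_of_nonneg_right (h y) ENNReal.toReal_nonneg

theorem sum_const_mul_toReal (p : PMF E) (k : ℝ) : ∑ y, k * (p y).toReal = k := by
  rw [← Finset.mul_sum, p.sum_toReal, mul_one]

theorem sum_mul_toReal_pos (p : PMF E) {f : E → ℝ} (h : ∀ y, 0 < f y) :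
    0 < ∑ y, f y * (p y).toReal := by
  obtain ⟨y, hy⟩ := p.support_nonempty
  exact Finset.sum_pos' (fun y _ => mul_nonneg (h y).le ENNReal.toReal_nonneg)
    ⟨y, Finset.mem_univ y, mul_pos (h y)
      (ENNReal.toReal_pos ((p.mem_support_iff y).1 hy) (p.apply_ne_top y))⟩

end PMF

namespace MDP

variable {E U : Type*}

/-! ### Entropic utility of the next state. -/

section NextUtility

variable [Fintype E] (M : MDP E U)

theorem nextUtility_zero (w : E → ℝ) (x : E) (a : U) :
    M.nextUtility 0 w x a = ∑ y, w y * (M.trans a x y).toReal := if_pos rfl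

theorem nextUtility_of_ne {γ : ℝ} (hγ : γ ≠ 0) (w : E → ℝ) (x : E) (a : U) :
    M.nextUtility γ w x a =
      1 / γ * Real.log (∑ y, Real.exp (γ * w y) * (M.trans a x y).toReal) := if_neg hγ

theorem mul_nextUtility {γ : ℝ} (hγ : γ ≠ 0) (w : E → ℝ) (x : E) (a : U) :
    γ * M.nextUtility γ w x a =
      Real.log (∑ y, Real.exp (γ * w y) * (M.trans a x y).toReal) := by
  rw [nextUtility_of_ne M hγ]
  field_simp

theorem exp_mul_nextUtility {γ : ℝ} (hγ : γ ≠ 0) (w : E → ℝ) (x : E) (a : U) :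
    Real.exp (γ * M.nextUtility γ w x a) =
      ∑ y, Real.exp (γ * w y) * (M.trans a x y).toReal := by
  rw [mul_nextUtility M hγ,
    Real.exp_log (PMF.sum_mul_toReal_pos _ fun _ => Real.exp_pos _)]

theorem nextUtility_mono (γ : ℝ) (x : E) (a : U) {v w : E → ℝ} (h : v ≤ w) :
    M.nextUtility γ v x a ≤ M.nextUtility γ w x a := by
  rcases lt_trichotomy γ 0 with hγ | rfl | hγ
  · refine (mul_le_mul_left_of_neg hγ).1 (Real.exp_le_exp.1 ?_)
    rw [exp_mul_nextUtility M hγ.ne, exp_mul_nextUtility M hγ.ne]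
    exact PMF.sum_mul_toReal_le _ fun y =>
      Real.exp_le_exp.2 (mul_le_mul_of_nonpos_left (h y) hγ.le)
  · rw [nextUtility_zero, nextUtility_zero]
    exact PMF.sum_mul_toReal_le _ h
  · refine le_of_mul_le_mul_left (Real.exp_le_exp.1 ?_) hγ
    rw [exp_mul_nextUtility M hγ.ne', exp_mul_nextUtility M hγ.ne']
    exact PMF.sum_mul_toReal_le _ fun y =>
      Real.exp_le_exp.2 (mul_le_mul_of_nonneg_left (h y) hγ.le)

theorem nextUtility_add_const (γ : ℝ) (w : E → ℝ) (k : ℝ) (x : E) (a : U) :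
    M.nextUtility γ (fun y => w y + k) x a = M.nextUtility γ w x a + k := by
  rcases eq_or_ne γ 0 with rfl | hγ
  · simp only [nextUtility_zero, add_mul, Finset.sum_add_distrib, PMF.sum_const_mul_toReal]
  · refine mul_left_cancel₀ hγ (Real.exp_injective ?_)
    rw [exp_mul_nextUtility M hγ, mul_add, Real.exp_add, exp_mul_nextUtility M hγ, Finset.sum_mul]
    refine Finset.sum_congr rfl fun y _ => ?_
    rw [mul_add, Real.exp_add]
    ring

theorem nextUtility_const_zero (γ : ℝ) (x : E) (a : U) : M.nextUtility γ 0 x a = 0 := by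
  rcases eq_or_ne γ 0 with rfl | hγ
  · simp [nextUtility_zero]
  · simp [nextUtility_of_ne M hγ, PMF.sum_toReal]

/-- Jensen's inequality for `exp`. Keeping the factor `γ` treats both signs at once. -/
theorem mul_nextUtility_zero_le {γ : ℝ} (hγ : γ ≠ 0) (w : E → ℝ) (x : E) (a : U) :
    γ * M.nextUtility 0 w x a ≤ γ * M.nextUtility γ w x a := by
  rw [← Real.exp_le_exp, exp_mul_nextUtility M hγ, nextUtility_zero]
  have := convexOn_exp.map_sum_le (t := Finset.univ) (w := fun y => (M.trans a x y).toReal)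
    (p := fun y => γ * w y) (fun _ _ => ENNReal.toReal_nonneg) (PMF.sum_toReal _)
    (fun _ _ => Set.mem_univ _)
  simp only [smul_eq_mul] at this
  simpa only [Finset.mul_sum, ← mul_assoc, mul_comm] using this

/-- The power mean inequality with exponent `s`, applied to `exp (γ w)`. -/
theorem mul_mul_nextUtility_le {γ s : ℝ} (hγ : γ ≠ 0) (hs : 1 ≤ s) (w : E → ℝ) (x : E) (a : U) :
    s * γ * M.nextUtility γ w x a ≤ s * γ * M.nextUtility (s * γ) w x a := by
  have hs0 : s ≠ 0 := by linarith
  rw [← Real.exp_le_exp, exp_mul_nextUtility M (mul_ne_zero hs0 hγ), mul_assoc,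
    mul_comm s, Real.exp_mul, exp_mul_nextUtility M hγ]
  have := Real.rpow_arith_mean_le_arith_mean_rpow Finset.univ
    (fun y => (M.trans a x y).toReal) (fun y => Real.exp (γ * w y))
    (fun _ _ => ENNReal.toReal_nonneg) (PMF.sum_toReal _) (fun _ _ => (Real.exp_pos _).le) hs
  simpa only [← Real.exp_mul, mul_comm, mul_left_comm] using this

theorem nextUtility_mono_param {γ γ' : ℝ} (h : γ ≤ γ') (w : E → ℝ) (x : E) (a : U) :
    M.nextUtility γ w x a ≤ M.nextUtility γ' w x a := by
  have hneg : ∀ {γ}, γ < 0 → M.nextUtility γ w x a ≤ M.nextUtility 0 w x a := fun hγ =>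
    (mul_le_mul_left_of_neg hγ).1 (mul_nextUtility_zero_le M hγ.ne w x a)
  have hpos : ∀ {γ}, 0 < γ → M.nextUtility 0 w x a ≤ M.nextUtility γ w x a := fun hγ =>
    le_of_mul_le_mul_left (mul_nextUtility_zero_le M hγ.ne' w x a) hγ
  rcases lt_trichotomy γ 0 with hγ | rfl | hγ
  · rcases lt_trichotomy γ' 0 with hγ' | rfl | hγ'
    -- Between negative parameters `γ` has the larger modulus, so the exponent is `γ / γ'`.
    · have := mul_mul_nextUtility_le M hγ'.ne ((one_le_div_of_neg hγ').2 h) w x a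
      rw [div_mul_cancel₀ _ hγ'.ne] at this
      exact (mul_le_mul_left_of_neg hγ).1 this
    · exact hneg hγ
    · exact (hneg hγ).trans (hpos hγ')
  · rcases h.eq_or_lt with rfl | hγ'
    · exact le_rfl
    · exact hpos hγ'
  · have := mul_mul_nextUtility_le M hγ.ne' ((one_le_div hγ).2 h) w x a
    rw [div_mul_cancel₀ _ hγ.ne'] at this
    exact le_of_mul_le_mul_left this (hγ.trans_le h)

end NextUtility

/-! ### The Bellman operator as a topical map. -/

section BellmanOperator

variable [Fintype E] (M : MDP E U)

/-- The Bellman operator `w ↦ max_a [c(x, a) + nextUtility γ w x a]`. -/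
noncomputable def bellmanOp (γ : ℝ) (w : E → ℝ) (x : E) : ℝ :=
  ⨆ a, M.reward x a + M.nextUtility γ w x a

theorem exists_forall_abs_reward_le [Finite U] : ∃ C, 0 ≤ C ∧ ∀ x a, |M.reward x a| ≤ C := by
  obtain ⟨C, hC⟩ := (Set.finite_range fun z : E × U => |M.reward z.1 z.2|).bddAbove
  exact ⟨max C 0, le_max_right _ _, fun x a => (hC ⟨(x, a), rfl⟩).trans (le_max_left _ _)⟩

variable [Finite U]

theorem le_bellmanOp (γ : ℝ) (w : E → ℝ) (x : E) (a : U) :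
    M.reward x a + M.nextUtility γ w x a ≤ M.bellmanOp γ w x :=
  le_ciSup (f := fun a => M.reward x a + M.nextUtility γ w x a) (Set.finite_range _).bddAbove a

variable [Nonempty U]

theorem exists_eq_bellmanOp (γ : ℝ) (w : E → ℝ) (x : E) :
    ∃ a, M.reward x a + M.nextUtility γ w x a = M.bellmanOp γ w x :=
  exists_eq_ciSup_of_finite (f := fun a => M.reward x a + M.nextUtility γ w x a)

theorem topical_bellmanOp (γ : ℝ) : Topical (M.bellmanOp γ) where
  mono v w h x := ciSup_le fun a =>
    (add_le_add_right (nextUtility_mono M γ x a h) _).trans (le_bellmanOp M γ w x a)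
  add_const w k x := by
    refine le_antisymm (ciSup_le fun a => ?_) ?_
    · rw [nextUtility_add_const, ← add_assoc]
      exact add_le_add_left (le_bellmanOp M γ w x a) k
    · obtain ⟨a, ha⟩ := exists_eq_bellmanOp M γ w x
      rw [← ha, add_assoc, ← nextUtility_add_const]
      exact le_bellmanOp M γ _ x a

theorem solvesBellman_iff (γ : ℝ) (w : E → ℝ) (l : ℝ) :
    M.SolvesBellman γ w l ↔ ∀ x, M.bellmanOp γ w x = w x + l := by
  refine forall_congr' fun x => ⟨fun h => ?_, fun h => ?_⟩
  · obtain ⟨a, ha⟩ := h.1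
    dsimp only at ha
    refine le_antisymm (ciSup_le fun b => ?_) ?_
    · have := h.2 ⟨b, rfl⟩
      dsimp only at this
      linarith
    · linarith [le_bellmanOp M γ w x a]
  · obtain ⟨a, ha⟩ := exists_eq_bellmanOp M γ w x
    refine ⟨⟨a, by dsimp only; linarith⟩, ?_⟩
    rintro _ ⟨b, rfl⟩
    dsimp only
    linarith [le_bellmanOp M γ w x b]

theorem solvesBellman_unique [Nonempty E] {γ : ℝ} {w w' : E → ℝ} {l l' : ℝ}
    (h : M.SolvesBellman γ w l) (h' : M.SolvesBellman γ w' l') : l = l' := by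
  rw [solvesBellman_iff] at h h'
  exact le_antisymm
    ((topical_bellmanOp M γ).eigenvalue_le (fun x => (h x).ge) fun x => (h' x).le)
    ((topical_bellmanOp M γ).eigenvalue_le (fun x => (h' x).ge) fun x => (h x).le)

/-- A solution at `γ` is a subsolution at `γ'`, because the utility increases with the parameter. -/
theorem solvesBellman_mono_param [Nonempty E] {γ γ' : ℝ} (hγ : γ ≤ γ') {w w' : E → ℝ} {l l' : ℝ}
    (h : M.SolvesBellman γ w l) (h' : M.SolvesBellman γ' w' l') : l ≤ l' := by
  rw [solvesBellman_iff] at h h'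
  refine (topical_bellmanOp M γ').eigenvalue_le (w := w) (fun x => ?_) fun x => (h' x).le
  obtain ⟨a, ha⟩ := exists_eq_bellmanOp M γ w x
  rw [← h x, ← ha]
  exact (add_le_add_right (nextUtility_mono_param M hγ w x a) _).trans (le_bellmanOp M γ' w x a)

/-- The zero function is a subsolution with constant `-C` and a supersolution with constant `C`. -/
theorem abs_le_of_solvesBellman [Nonempty E] {γ : ℝ} {w : E → ℝ} {l C : ℝ}
    (hC : ∀ x a, |M.reward x a| ≤ C) (h : M.SolvesBellman γ w l) : |l| ≤ C := by
  rw [solvesBellman_iff] at h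
  have h0 : ∀ x, ∃ a, M.bellmanOp γ 0 x = M.reward x a := fun x => by
    obtain ⟨a, ha⟩ := exists_eq_bellmanOp M γ 0 x
    exact ⟨a, by rw [← ha, nextUtility_const_zero, add_zero]⟩
  rw [abs_le]
  constructor
  · refine (topical_bellmanOp M γ).eigenvalue_le (w := 0) (fun x => ?_) fun x => (h x).le
    obtain ⟨a, ha⟩ := h0 x
    rw [ha]
    simpa using (abs_le.1 (hC x a)).1
  · refine (topical_bellmanOp M γ).eigenvalue_le (w' := 0) (fun x => (h x).ge) fun x => ?_
    obtain ⟨a, ha⟩ := h0 x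
    rw [ha]
    simpa using (abs_le.1 (hC x a)).2

end BellmanOperator

/-! ### Oscillation bounds from mixing and transition equivalence. -/

section Ergodicity

/-- The one-step transition laws differ by at most `δ` in total variation. -/
def MixingBound (M : MDP E U) (δ : ℝ) : Prop :=
  ∀ (x x' : E) (a a' : U) (A : Finset E),
    ∑ y ∈ A, (M.trans a x y).toReal - ∑ y ∈ A, (M.trans a' x' y).toReal ≤ δ

/-- The `N`-step transition laws of every Markov policy are comparable with constant `K`. -/
def RatioBound (M : MDP E U) (N : ℕ) (K : ℝ) : Prop :=
  ∀ (x x' y : E) (v : ℕ → E → U), (M.nStep v N x y).toReal ≤ K * (M.nStep v N x' y).toReal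

/-- All index sets are finite, so the real suprema are over bounded families and `δ` can be the
supremum itself. -/
theorem OneStepMixing.exists_mixingBound [Finite E] [Finite U] [MeasurableSpace E]
    [DiscreteMeasurableSpace E] {M : MDP E U} (h : M.OneStepMixing) :
    ∃ δ < 1, M.MixingBound δ := by
  refine ⟨_, h, fun x x' a a' A => ?_⟩
  have hreal : ∀ p : PMF E, p.toMeasure.real (A : Set E) = ∑ y ∈ A, (p y).toReal := fun p => by
    rw [Measure.real, PMF.toMeasure_apply_finset,
      ENNReal.toReal_sum fun y _ => p.apply_ne_top y]
  rw [← hreal, ← hreal]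
  refine (le_abs_self _).trans ?_
  refine le_trans ?_ (le_ciSup (Set.finite_range _).bddAbove x)
  refine le_trans ?_ (le_ciSup (Set.finite_range _).bddAbove x')
  refine le_trans ?_ (le_ciSup (Set.finite_range _).bddAbove (A : Set E))
  refine le_trans ?_ (le_ciSup (Set.finite_range _).bddAbove a)
  exact le_ciSup (f := fun a' => |(M.trans a x).toMeasure.real (A : Set E) -
    (M.trans a' x').toMeasure.real (A : Set E)|) (Set.finite_range _).bddAbove a'

/-- `K` is the supremum itself. Its finiteness excludes a positive probability over a zero one, and
for a zero numerator the bound is trivial. -/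
theorem TransitionEquivalence.exists_ratioBound {M : MDP E U} (h : M.TransitionEquivalence) :
    ∃ N K, M.RatioBound N K := by
  obtain ⟨N, hN⟩ := h
  refine ⟨N, (⨆ (x : E) (x' : E) (y : E) (v : ℕ → E → U),
      ratio (M.nStep v N x y) (M.nStep v N x' y)).toReal, fun x x' y v => ?_⟩
  have hle : ratio (M.nStep v N x y) (M.nStep v N x' y) ≤ ⨆ (x : E) (x' : E) (y : E)
      (v : ℕ → E → U), ratio (M.nStep v N x y) (M.nStep v N x' y) :=
    le_iSup_of_le x <| le_iSup_of_le x' <| le_iSup_of_le y <| le_iSup_of_le v le_rfl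
  rw [← ENNReal.toReal_mul]
  refine ENNReal.toReal_mono (ENNReal.mul_ne_top hN.ne (PMF.apply_ne_top _ _)) ?_
  by_cases h0 : M.nStep v N x y = 0
  · simp [h0]
  · rw [ratio, if_neg fun h => h0 h.1] at hle
    by_cases hb : M.nStep v N x' y = 0
    · rw [hb, ENNReal.div_zero h0] at hle
      exact absurd (hle.trans_lt hN) (lt_irrefl _)
    · exact (ENNReal.div_le_iff_le_mul (Or.inl hb) (Or.inl (PMF.apply_ne_top _ _))).1 hle

theorem nStep_succ_toReal [Fintype E] (M : MDP E U) (v : ℕ → E → U) (n : ℕ) (x z : E) :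
    (M.nStep v (n + 1) x z).toReal =
      ∑ y, (M.nStep v n x y).toReal * (M.trans (v n y) y z).toReal := by
  simp only [nStep, PMF.bind_apply, tsum_fintype]
  rw [ENNReal.toReal_sum fun y _ => ENNReal.mul_ne_top (PMF.apply_ne_top _ _)
    (PMF.apply_ne_top _ _)]
  simp only [ENNReal.toReal_mul]

theorem sum_mul_nStep_succ [Fintype E] (M : MDP E U) (v : ℕ → E → U) (n : ℕ) (x : E)
    (f : E → ℝ) : ∑ z, f z * (M.nStep v (n + 1) x z).toReal =
      ∑ y, (∑ z, f z * (M.trans (v n y) y z).toReal) * (M.nStep v n x y).toReal := by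
  simp only [nStep_succ_toReal, Finset.mul_sum, Finset.sum_mul]
  rw [Finset.sum_comm]
  exact Finset.sum_congr rfl fun y _ => Finset.sum_congr rfl fun z _ => by ring

variable [Fintype E] {M : MDP E U}

/-- Hahn decomposition: once `w` is shifted to have minimum 0, only the points with `q ≤ p`
contribute positively, and their excess mass is at most `δ`. -/
theorem MixingBound.nextUtility_zero_sub_le {δ : ℝ} (h : M.MixingBound δ) {w : E → ℝ} {s : ℝ}
    (hw : ∀ x y, w x - w y ≤ s) (x x' : E) (a a' : U) :
    M.nextUtility 0 w x a - M.nextUtility 0 w x' a' ≤ δ * s := by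
  classical
  have hne : Nonempty E := ⟨x⟩
  obtain ⟨i, hi⟩ := Finite.exists_min w
  obtain ⟨j, hj⟩ := Finite.exists_max w
  set p := fun y => (M.trans a x y).toReal
  set q := fun y => (M.trans a' x' y).toReal
  have hp : ∑ y, p y = 1 := PMF.sum_toReal _
  have hq : ∑ y, q y = 1 := PMF.sum_toReal _
  set A := Finset.univ.filter fun y => q y ≤ p y
  have hA := h x x' a a' A
  have hA0 : 0 ≤ ∑ y ∈ A, p y - ∑ y ∈ A, q y := by
    rw [← Finset.sum_sub_distrib]
    exact Finset.sum_nonneg fun y hy => sub_nonneg.2 (Finset.mem_filter.1 hy).2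
  calc M.nextUtility 0 w x a - M.nextUtility 0 w x' a'
      = ∑ y, (w y - w i) * (p y - q y) := by
        simp only [nextUtility_zero, sub_mul, mul_sub, Finset.sum_sub_distrib, ← Finset.mul_sum,
          hp, hq]
        simp [p, q]
    _ ≤ ∑ y, if q y ≤ p y then (w j - w i) * (p y - q y) else 0 := by
        refine Finset.sum_le_sum fun y _ => ?_
        split_ifs with hy
        · exact mul_le_mul_of_nonneg_right (by linarith [hj y]) (sub_nonneg.2 hy)
        · exact mul_nonpos_of_nonneg_of_nonpos (sub_nonneg.2 (hi y)) (by linarith)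
    _ = (w j - w i) * (∑ y ∈ A, p y - ∑ y ∈ A, q y) := by
        rw [← Finset.sum_filter, ← Finset.mul_sum, Finset.sum_sub_distrib]
    _ ≤ s * δ := mul_le_mul (hw j i) hA hA0 ((sub_self (w i)).symm.le.trans (hw i i))
    _ = δ * s := mul_comm _ _

theorem exp_mul_bellmanOp {γ : ℝ} (hγ : γ ≠ 0) (w : E → ℝ) {x : E} {a : U}
    (ha : M.reward x a + M.nextUtility γ w x a = M.bellmanOp γ w x) :
    Real.exp (γ * M.bellmanOp γ w x) = Real.exp (γ * M.reward x a) *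
      ∑ y, Real.exp (γ * w y) * (M.trans a x y).toReal := by
  rw [← ha, mul_add, Real.exp_add, exp_mul_nextUtility M hγ]

/-- The multiplicative cost along a Markov policy is comparable with the transition law. -/
theorem exp_le_and_le_of_greedy {γ C : ℝ} (hC : ∀ x a, |M.reward x a| ≤ C) {N : ℕ}
    {v : ℕ → E → U} {g : ℕ → E → ℝ}
    (hg : ∀ k < N, ∀ y, Real.exp (γ * g k y) = Real.exp (γ * M.reward y (v k y)) *
      ∑ z, Real.exp (γ * g (k + 1) z) * (M.trans (v k y) y z).toReal) (x : E) {n : ℕ}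
    (hn : n ≤ N) :
    Real.exp (-(n * (|γ| * C))) * ∑ y, Real.exp (γ * g n y) * (M.nStep v n x y).toReal ≤
        Real.exp (γ * g 0 x) ∧
      Real.exp (γ * g 0 x) ≤
        Real.exp (n * (|γ| * C)) * ∑ y, Real.exp (γ * g n y) * (M.nStep v n x y).toReal := by
  classical
  induction n with
  | zero =>
    have : ∑ y, Real.exp (γ * g 0 y) * (M.nStep v 0 x y).toReal = Real.exp (γ * g 0 x) := by
      rw [Finset.sum_eq_single x]
      · simp [nStep]
      · intro y _ hy; simp [nStep, hy]
      · simp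
    rw [this]
    simp
  | succ n ih =>
    obtain ⟨h1, h2⟩ := ih (Nat.le_of_succ_le hn)
    have hbd : ∀ y, |γ * M.reward y (v n y)| ≤ |γ| * C := fun y => by
      rw [abs_mul]
      exact mul_le_mul_of_nonneg_left (hC _ _) (abs_nonneg γ)
    have hpos : ∀ y, 0 ≤ ∑ z, Real.exp (γ * g (n + 1) z) * (M.trans (v n y) y z).toReal :=
      fun y => (PMF.sum_mul_toReal_pos _ fun _ => Real.exp_pos _).le
    rw [sum_mul_nStep_succ]
    constructor
    · refine le_trans ?_ h1
      rw [show -(((n + 1 : ℕ) : ℝ) * (|γ| * C)) = -(n * (|γ| * C)) + -(|γ| * C) by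
        push_cast; ring, Real.exp_add, mul_assoc]
      refine mul_le_mul_of_nonneg_left ?_ (Real.exp_pos _).le
      rw [Finset.mul_sum]
      refine Finset.sum_le_sum fun y _ => ?_
      rw [← mul_assoc]
      refine mul_le_mul_of_nonneg_right ?_ ENNReal.toReal_nonneg
      rw [hg n hn]
      exact mul_le_mul_of_nonneg_right (Real.exp_le_exp.2 (abs_le.1 (hbd y)).1) (hpos y)
    · refine h2.trans ?_
      rw [show (((n + 1 : ℕ) : ℝ) * (|γ| * C)) = (n * (|γ| * C)) + (|γ| * C) by
        push_cast; ring, Real.exp_add, mul_assoc]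
      refine mul_le_mul_of_nonneg_left ?_ (Real.exp_pos _).le
      rw [Finset.mul_sum]
      refine Finset.sum_le_sum fun y _ => ?_
      rw [← mul_assoc]
      refine mul_le_mul_of_nonneg_right ?_ ENNReal.toReal_nonneg
      rw [hg n hn]
      exact mul_le_mul_of_nonneg_right (Real.exp_le_exp.2 (abs_le.1 (hbd y)).2) (hpos y)

variable [Finite U] [Nonempty U]

theorem MixingBound.bellmanOp_sub_le {δ C : ℝ} (h : M.MixingBound δ)
    (hC : ∀ x a, |M.reward x a| ≤ C) {w : E → ℝ} {s : ℝ} (hw : ∀ x y, w x - w y ≤ s) (x x' : E) :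
    M.bellmanOp 0 w x - M.bellmanOp 0 w x' ≤ 2 * C + δ * s := by
  obtain ⟨a, ha⟩ := exists_eq_bellmanOp M 0 w x
  linarith [le_bellmanOp M 0 w x' a, h.nextUtility_zero_sub_le hw x x' a a,
    (abs_le.1 (hC x a)).2, (abs_le.1 (hC x' a)).1]

/-- The bound is the fixed point of the recursion `s ↦ 2 * C + δ * s` for oscillations. -/
theorem MixingBound.iterate_sub_le {δ C : ℝ} (h : M.MixingBound δ) (hδ : δ < 1)
    (hC0 : 0 ≤ C) (hC : ∀ x a, |M.reward x a| ≤ C) (n : ℕ) :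
    ∀ x x', (M.bellmanOp 0)^[n] 0 x - (M.bellmanOp 0)^[n] 0 x' ≤ 2 * C / (1 - δ) := by
  have h1 : 0 < 1 - δ := by linarith
  induction n with
  | zero => intro x x'; simp; positivity
  | succ n ih =>
    intro x x'
    rw [Function.iterate_succ_apply']
    refine (h.bellmanOp_sub_le hC ih x x').trans (le_of_eq ?_)
    field_simp
    ring

/-- The exponential of the `N`-th iterate is an expectation along a greedy Markov policy. Changing
the starting point costs a factor `K`, and removing and restoring the rewards costs `exp (N * (|γ| *
C))` each. It matters that `D` does not depend on `w`. -/
theorem RatioBound.exists_iterate_sub_le {N : ℕ} {K γ C : ℝ} (h : M.RatioBound N K) (hγ : γ ≠ 0)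
    (hC : ∀ x a, |M.reward x a| ≤ C) :
    ∃ D, ∀ w x x', (M.bellmanOp γ)^[N] w x - (M.bellmanOp γ)^[N] w x' ≤ D := by
  set B := Real.exp (N * (|γ| * C)) * K * Real.exp (N * (|γ| * C))
  refine ⟨|Real.log B| / |γ|, fun w x x' => ?_⟩
  -- Value iteration runs backwards in time: the action at time `k` is greedy for the value with `N
  -- - 1 - k` steps to go.
  choose v hv using fun k => exists_eq_bellmanOp M γ ((M.bellmanOp γ)^[N - 1 - k] w)
  set g : ℕ → E → ℝ := fun k => (M.bellmanOp γ)^[N - k] w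
  have hg : ∀ k < N, ∀ y, Real.exp (γ * g k y) = Real.exp (γ * M.reward y (v k y)) *
      ∑ z, Real.exp (γ * g (k + 1) z) * (M.trans (v k y) y z).toReal := fun k hk y => by
    have hgk : g k = M.bellmanOp γ ((M.bellmanOp γ)^[N - 1 - k] w) := by
      rw [← Function.iterate_succ_apply' (M.bellmanOp γ)]
      exact congrArg (fun m => (M.bellmanOp γ)^[m] w) (by lia)
    have hgk' : g (k + 1) = (M.bellmanOp γ)^[N - 1 - k] w :=
      congrArg (fun m => (M.bellmanOp γ)^[m] w) (by lia)
    rw [hgk, hgk']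
    exact exp_mul_bellmanOp hγ _ (hv k y)
  have key : ∀ x x', Real.exp (γ * g 0 x) ≤ B * Real.exp (γ * g 0 x') := fun x x' => by
    have h1 := (exp_le_and_le_of_greedy hC hg x le_rfl).2
    have h2 := (exp_le_and_le_of_greedy hC hg x' le_rfl).1
    set S := fun x => ∑ y, Real.exp (γ * g N y) * (M.nStep v N x y).toReal
    have hS : S x ≤ K * S x' := by
      simp only [S, Finset.mul_sum]
      refine Finset.sum_le_sum fun y _ => ?_
      have := mul_le_mul_of_nonneg_left (h x x' y v) (Real.exp_pos (γ * g N y)).le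
      linarith
    have hS' : S x' ≤ Real.exp (N * (|γ| * C)) * Real.exp (γ * g 0 x') := by
      rw [Real.exp_neg, inv_mul_le_iff₀ (Real.exp_pos _)] at h2
      exact h2
    have hSx : 0 < S x := PMF.sum_mul_toReal_pos _ fun _ => Real.exp_pos _
    have hSx' : 0 < S x' := PMF.sum_mul_toReal_pos _ fun _ => Real.exp_pos _
    have hK : 0 ≤ K := (pos_of_mul_pos_left (hSx.trans_le hS) hSx'.le).le
    calc Real.exp (γ * g 0 x) ≤ Real.exp (N * (|γ| * C)) * (K * S x') :=
          h1.trans (mul_le_mul_of_nonneg_left hS (Real.exp_pos _).le)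
      _ ≤ Real.exp (N * (|γ| * C)) *
            (K * (Real.exp (N * (|γ| * C)) * Real.exp (γ * g 0 x'))) := by gcongr
      _ = B * Real.exp (γ * g 0 x') := by simp only [B]; ring
  have hB : 0 < B := pos_of_mul_pos_left ((Real.exp_pos _).trans_le (key x x)) (Real.exp_pos _).le
  have hlog : ∀ x x', γ * (g 0 x - g 0 x') ≤ |Real.log B| := fun x x' => by
    have := key x x'
    rw [← Real.exp_log hB, ← Real.exp_add, Real.exp_le_exp] at this
    linarith [le_abs_self (Real.log B)]
  rw [le_div_iff₀ (abs_pos.2 hγ), mul_comm]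
  have hx : ∀ x, (M.bellmanOp γ)^[N] w x = g 0 x := fun x => rfl
  rw [hx, hx]
  -- For negative `γ` the roles of `x` and `x'` are exchanged.
  rcases abs_choice γ with h | h <;> rw [h]
  · exact hlog x x'
  · linarith [hlog x' x]

theorem exists_solvesBellman [Nonempty E] {δ : ℝ} (hδ : δ < 1) (h1 : M.MixingBound δ) {N : ℕ}
    {K : ℝ} (h2 : M.RatioBound N K) (γ : ℝ) : ∃ w l, M.SolvesBellman γ w l := by
  obtain ⟨C, hC0, hC⟩ := exists_forall_abs_reward_le M
  simp only [solvesBellman_iff]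
  rcases eq_or_ne γ 0 with rfl | hγ
  · exact (topical_bellmanOp M 0).exists_eigenvector (h1.iterate_sub_le hδ hC0 hC)
  · obtain ⟨D, hD⟩ := h2.exists_iterate_sub_le hγ hC
    -- `D` controls all iterates from `N` on; `D'` controls the finitely many earlier ones.
    obtain ⟨D', hD'⟩ := (Set.finite_range fun z : Fin N × E × E =>
      (M.bellmanOp γ)^[z.1] 0 z.2.1 - (M.bellmanOp γ)^[z.1] 0 z.2.2).bddAbove
    refine (topical_bellmanOp M γ).exists_eigenvector (K := max D D') fun n x y => ?_
    rcases lt_or_ge n N with hn | hn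
    · exact le_max_of_le_right (hD' ⟨(⟨n, hn⟩, x, y), rfl⟩)
    · obtain ⟨m, rfl⟩ := Nat.exists_eq_add_of_le hn
      rw [Function.iterate_add_apply]
      exact le_max_of_le_left (hD _ x y)

end Ergodicity

/-! ### Stationary policies as processes with a single action. -/

section Restrict

/-- The uncontrolled process obtained by following the stationary policy `u`. -/
def restrict (M : MDP E U) (u : E → U) : MDP E Unit where
  trans _ x := M.trans (u x) x
  reward x _ := M.reward x (u x)

theorem restrict_nStep (M : MDP E U) (u : E → U) (v : ℕ → E → Unit) (n : ℕ) :
    (M.restrict u).nStep v n = M.nStep (fun _ => u) n := by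
  induction n with
  | zero => rfl
  | succ n ih => funext x; simp only [nStep, ih]; rfl

theorem MixingBound.restrict {M : MDP E U} {δ : ℝ} (h : M.MixingBound δ) (u : E → U) :
    (M.restrict u).MixingBound δ := fun x x' _ _ A => h x x' (u x) (u x') A

theorem RatioBound.restrict {M : MDP E U} {N : ℕ} {K : ℝ} (h : M.RatioBound N K) (u : E → U) :
    (M.restrict u).RatioBound N K := fun x x' y v => by
  rw [restrict_nStep]
  exact h x x' y _

variable [Fintype E]

theorem solvesPoisson_iff_restrict (M : MDP E U) (u : E → U) (γ : ℝ) (w : E → ℝ) (l : ℝ) :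
    M.SolvesPoisson u γ w l ↔ (M.restrict u).SolvesBellman γ w l := by
  refine forall_congr' fun x => ?_
  rw [Set.range_unique]
  exact ⟨fun h => h ▸ isGreatest_singleton, fun h => h.1⟩

theorem exists_solvesPoisson_of_solvesBellman {M : MDP E U} {γ : ℝ}
    {w : E → ℝ} {l : ℝ} (h : M.SolvesBellman γ w l) : ∃ u, M.SolvesPoisson u γ w l := by
  choose u hu using fun x => (h x).1
  exact ⟨u, fun x => (hu x).symm⟩

theorem SolvesPoisson.le_of_solvesBellman [Nonempty E] [Finite U] [Nonempty U] {M : MDP E U}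
    {u : E → U} {γ : ℝ} {w w' : E → ℝ} {l l' : ℝ} (h : M.SolvesPoisson u γ w l)
    (h' : M.SolvesBellman γ w' l') : l ≤ l' := by
  rw [solvesBellman_iff] at h'
  refine (topical_bellmanOp M γ).eigenvalue_le (w := w) (fun x => ?_) fun x => (h' x).le
  linarith [h x, le_bellmanOp M γ w x (u x)]

end Restrict

end MDP

/-! ### Functions of a finite history. -/

section DependsOn

variable {E : Type*}

/-- Extend a finite history to a trajectory that is constant after time `n`. -/
def extendHistory {n : ℕ} (h : Finset.Iic n → E) (i : ℕ) : E :=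
  h ⟨min i n, Finset.mem_Iic.2 (min_le_right i n)⟩

theorem DependsOn.extendHistory_frestrictLe {β : Type*} {n : ℕ} {Z : (ℕ → E) → β}
    (hZ : DependsOn Z (Set.Iic n)) (ω : ℕ → E) :
    Z (extendHistory (Preorder.frestrictLe (π := fun _ => E) n ω)) = Z ω :=
  hZ fun i hi => by
    simp only [extendHistory, Preorder.frestrictLe_apply]
    rw [min_eq_left hi]

variable [Finite E] [MeasurableSpace E] [DiscreteMeasurableSpace E]

/-- Such a function factors through the finite set of histories. -/
theorem DependsOn.integrable {n : ℕ} {Z : (ℕ → E) → ℝ} (hZ : DependsOn Z (Set.Iic n))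
    (μ : Measure (ℕ → E)) [IsFiniteMeasure μ] : Integrable Z μ := by
  have hZ' : Z = (fun h => Z (extendHistory h)) ∘ Preorder.frestrictLe (π := fun _ => E) n :=
    funext fun ω => (hZ.extendHistory_frestrictLe ω).symm
  rw [hZ']
  exact Integrable.comp_measurable Integrable.of_finite
    (Preorder.measurable_frestrictLe n)

end DependsOn

namespace MDP

variable {E U : Type*}

/-! ### Entropic utility of a random variable. -/

section EntropicUtility

variable {Ω : Type*} [MeasurableSpace Ω]

/-- Entropic utility of a random variable, with the expectation as the case `γ = 0`. -/
noncomputable def entropicUtility (μ : Measure Ω) (γ : ℝ) (Z : Ω → ℝ) : ℝ :=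
  if γ = 0 then ∫ ω, Z ω ∂μ else 1 / γ * Real.log (∫ ω, Real.exp (γ * Z ω) ∂μ)

theorem entropicUtility_zero (μ : Measure Ω) (Z : Ω → ℝ) :
    entropicUtility μ 0 Z = ∫ ω, Z ω ∂μ := if_pos rfl

theorem entropicUtility_of_ne (μ : Measure Ω) {γ : ℝ} (hγ : γ ≠ 0) (Z : Ω → ℝ) :
    entropicUtility μ γ Z = 1 / γ * Real.log (∫ ω, Real.exp (γ * Z ω) ∂μ) := if_neg hγ

theorem mul_entropicUtility (μ : Measure Ω) {γ : ℝ} (hγ : γ ≠ 0) (Z : Ω → ℝ) :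
    γ * entropicUtility μ γ Z = Real.log (∫ ω, Real.exp (γ * Z ω) ∂μ) := by
  rw [entropicUtility_of_ne μ hγ]
  field_simp

theorem entropicUtility_mono (μ : Measure Ω) [NeZero μ] {γ : ℝ} {Z Z' : Ω → ℝ}
    (hi : Integrable Z μ) (hi' : Integrable Z' μ)
    (he : Integrable (fun ω => Real.exp (γ * Z ω)) μ)
    (he' : Integrable (fun ω => Real.exp (γ * Z' ω)) μ) (h : ∀ ω, Z ω ≤ Z' ω) :
    entropicUtility μ γ Z ≤ entropicUtility μ γ Z' := by
  rcases lt_trichotomy γ 0 with hγ | rfl | hγ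
  · refine (mul_le_mul_left_of_neg hγ).1 ?_
    rw [mul_entropicUtility μ hγ.ne, mul_entropicUtility μ hγ.ne]
    exact Real.log_le_log (integral_exp_pos he') (integral_mono he' he fun ω =>
      Real.exp_le_exp.2 (mul_le_mul_of_nonpos_left (h ω) hγ.le))
  · rw [entropicUtility_zero, entropicUtility_zero]
    exact integral_mono hi hi' h
  · refine le_of_mul_le_mul_left ?_ hγ
    rw [mul_entropicUtility μ hγ.ne', mul_entropicUtility μ hγ.ne']
    exact Real.log_le_log (integral_exp_pos he) (integral_mono he he' fun ω =>
      Real.exp_le_exp.2 (mul_le_mul_of_nonneg_left (h ω) hγ.le))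

theorem entropicUtility_add_const (μ : Measure Ω) [IsProbabilityMeasure μ] {γ : ℝ} {Z : Ω → ℝ}
    (hi : Integrable Z μ) (he : Integrable (fun ω => Real.exp (γ * Z ω)) μ) (k : ℝ) :
    entropicUtility μ γ (fun ω => Z ω + k) = entropicUtility μ γ Z + k := by
  rcases eq_or_ne γ 0 with rfl | hγ
  · rw [entropicUtility_zero, entropicUtility_zero, integral_add hi (integrable_const k)]
    simp
  · refine mul_left_cancel₀ hγ ?_
    simp only [mul_add, mul_entropicUtility μ hγ, Real.exp_add, integral_mul_const]
    rw [Real.log_mul (integral_exp_pos he).ne' (Real.exp_pos _).ne', Real.log_exp]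

end EntropicUtility

/-! ### Dynamic programming under the law of a policy. -/

section Law

variable (M : MDP E U)

theorem dependsOn_action (π : Policy E U) {i n : ℕ} (hi : i ≤ n) :
    DependsOn (π.action i) (Set.Iic n) := fun _ _ h =>
  congrArg (π i) (funext fun j => h j ((Finset.mem_Iic.1 j.2).trans hi))

theorem dependsOn_reward (π : Policy E U) {i n : ℕ} (hi : i ≤ n) :
    DependsOn (fun ω => M.reward (ω i) (π.action i ω)) (Set.Iic n) := fun _ _ h => by
  dsimp only
  rw [dependsOn_action π hi h, h i hi]

theorem dependsOn_totalReward (π : Policy E U) (n : ℕ) :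
    DependsOn (M.totalReward π n) (Set.Iic n) := fun _ _ h =>
  Finset.sum_congr rfl fun _ hi => dependsOn_reward M π (Finset.mem_range.1 hi).le h

theorem totalReward_succ (π : Policy E U) (n : ℕ) (ω : ℕ → E) :
    M.totalReward π (n + 1) ω = M.totalReward π n ω + M.reward (ω n) (π.action n ω) :=
  Finset.sum_range_succ _ _

theorem dependsOn_totalReward_add (π : Policy E U) (n : ℕ) (w : E → ℝ) :
    DependsOn (fun ω => M.totalReward π n ω + w (ω n)) (Set.Iic n) := fun _ _ h => by
  dsimp only
  rw [dependsOn_totalReward M π n h, h n (Set.mem_Iic.2 le_rfl)]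

variable [Fintype E]

theorem dependsOn_totalReward_step (γ : ℝ) (w : E → ℝ) (π : Policy E U) (n : ℕ) :
    DependsOn (fun ω => M.totalReward π n ω + (M.reward (ω n) (π.action n ω) +
        M.nextUtility γ w (ω n) (π.action n ω))) (Set.Iic n) := fun _ _ h => by
  dsimp only
  rw [dependsOn_totalReward M π n h, dependsOn_action π le_rfl h, h n (Set.mem_Iic.2 le_rfl)]

variable [MeasurableSpace E] [DiscreteMeasurableSpace E]

instance (π : Policy E U) (x : E) : IsProbabilityMeasure (M.law π x) := by
  unfold law; infer_instance

theorem integral_law_zero (π : Policy E U) (x : E) (f : E → ℝ) :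
    ∫ ω, f (ω 0) ∂(M.law π x) = f x := by
  have h : (M.law π x).map (Preorder.frestrictLe (π := fun _ => E) 0) =
      Measure.dirac fun _ => x := by
    rw [law, Kernel.traj_map_frestrictLe_apply, Kernel.partialTraj_self, Kernel.id_apply]
  have := integral_map (μ := M.law π x) (φ := Preorder.frestrictLe (π := fun _ => E) 0)
    (Preorder.measurable_frestrictLe 0).aemeasurable
    (f := fun h => f (h ⟨0, Finset.mem_Iic.2 le_rfl⟩)) Measurable.of_discrete.aestronglyMeasurable
  rw [h, integral_dirac] at this
  exact this.symm

/-- Conditioning on the history up to time `n`. -/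
theorem integral_law_succ (π : Policy E U) (x : E) {n : ℕ} {Φ : (ℕ → E) → E → ℝ}
    (hΦ : DependsOn Φ (Set.Iic n)) :
    ∫ ω, Φ ω (ω (n + 1)) ∂(M.law π x) =
      ∫ ω, ∑ y, Φ ω y * (M.trans (π.action n ω) (ω n) y).toReal ∂(M.law π x) := by
  have hm : Measurable fun ω : ℕ → E =>
      (Preorder.frestrictLe (π := fun _ => E) n ω, ω (n + 1)) := by fun_prop
  have h1 := integral_map (μ := M.law π x) hm.aemeasurable
    (f := fun z => Φ (extendHistory z.1) z.2) (by fun_prop)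
  have h2 := integral_map (μ := M.law π x) (φ := Preorder.frestrictLe (π := fun _ => E) n)
    (Preorder.measurable_frestrictLe n).aemeasurable
    (f := fun h => ∫ y, Φ (extendHistory h) y ∂(M.stepKernel π n h)) (by fun_prop)
  simp only [hΦ.extendHistory_frestrictLe] at h1 h2
  rw [← h1]
  have h3 := Kernel.partialTraj_compProd_eq_map_traj (X := fun _ => E) (κ := M.stepKernel π)
    (Nat.zero_le n) (x₀ := fun _ => x)
  rw [law, ← h3, Measure.integral_compProd Integrable.of_finite,
    ← Kernel.traj_map_frestrictLe_apply]
  refine h2.trans (integral_congr_ae (Eventually.of_forall fun ω => ?_))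
  refine (PMF.integral_eq_sum _ _).trans (Finset.sum_congr rfl fun y _ => ?_)
  rw [smul_eq_mul, mul_comm]
  rfl

theorem entropicUtility_law_mono (π : Policy E U) (x : E) (γ : ℝ) {n : ℕ} {Z Z' : (ℕ → E) → ℝ}
    (hZ : DependsOn Z (Set.Iic n)) (hZ' : DependsOn Z' (Set.Iic n)) (h : ∀ ω, Z ω ≤ Z' ω) :
    entropicUtility (M.law π x) γ Z ≤ entropicUtility (M.law π x) γ Z' :=
  entropicUtility_mono _ (hZ.integrable _) (hZ'.integrable _)
    (DependsOn.integrable (fun _ _ h => by rw [hZ h]) _)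
    (DependsOn.integrable (fun _ _ h => by rw [hZ' h]) _) h

theorem entropicUtility_law_add_const (π : Policy E U) (x : E) (γ : ℝ) {n : ℕ}
    {Z : (ℕ → E) → ℝ} (hZ : DependsOn Z (Set.Iic n)) (k : ℝ) :
    entropicUtility (M.law π x) γ (fun ω => Z ω + k) = entropicUtility (M.law π x) γ Z + k :=
  entropicUtility_add_const _ (hZ.integrable _)
    (DependsOn.integrable (fun _ _ h => by rw [hZ h]) _) k

/-- The tower property of the entropic utility. -/
theorem entropicUtility_law_succ (π : Policy E U) (x : E) (γ : ℝ) {n : ℕ} {Z : (ℕ → E) → ℝ}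
    (hZ : DependsOn Z (Set.Iic n)) (w : E → ℝ) :
    entropicUtility (M.law π x) γ (fun ω => Z ω + w (ω (n + 1))) =
      entropicUtility (M.law π x) γ
        (fun ω => Z ω + M.nextUtility γ w (ω n) (π.action n ω)) := by
  rcases eq_or_ne γ 0 with rfl | hγ
  · rw [entropicUtility_zero, entropicUtility_zero,
      integral_law_succ M π x (Φ := fun ω y => Z ω + w y) fun _ _ h => by
        dsimp only; rw [hZ h]]
    simp only [nextUtility_zero, add_mul, Finset.sum_add_distrib, PMF.sum_const_mul_toReal]
  · rw [entropicUtility_of_ne _ hγ, entropicUtility_of_ne _ hγ,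
      integral_law_succ M π x (Φ := fun ω y => Real.exp (γ * (Z ω + w y))) fun _ _ h => by
        dsimp only; rw [hZ h]]
    simp only [mul_add, Real.exp_add, mul_assoc, ← Finset.mul_sum,
      ← exp_mul_nextUtility M hγ]

/-- Utility of the reward of the first `n` steps with the terminal reward `w`. -/
noncomputable def terminalUtility (γ : ℝ) (w : E → ℝ) (x : E) (π : Policy E U) (n : ℕ) : ℝ :=
  entropicUtility (M.law π x) γ fun ω => M.totalReward π n ω + w (ω n)

theorem entropicReward_eq (γ : ℝ) (x : E) (π : Policy E U) (n : ℕ) :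
    M.entropicReward γ x π n = entropicUtility (M.law π x) γ (M.totalReward π n) := rfl

theorem terminalUtility_zero (γ : ℝ) (w : E → ℝ) (x : E) (π : Policy E U) :
    M.terminalUtility γ w x π 0 = w x := by
  have hZ : (fun ω => M.totalReward π 0 ω + w (ω 0)) = fun ω : ℕ → E => w (ω 0) := by
    funext ω; simp [totalReward]
  rw [terminalUtility, hZ]
  rcases eq_or_ne γ 0 with rfl | hγ
  · rw [entropicUtility_zero, integral_law_zero]
  · rw [entropicUtility_of_ne _ hγ, integral_law_zero M π x fun y => Real.exp (γ * w y),
      Real.log_exp]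
    field_simp

theorem terminalUtility_succ (γ : ℝ) (w : E → ℝ) (x : E) (π : Policy E U) (n : ℕ) :
    M.terminalUtility γ w x π (n + 1) = entropicUtility (M.law π x) γ fun ω =>
      M.totalReward π n ω + (M.reward (ω n) (π.action n ω) +
        M.nextUtility γ w (ω n) (π.action n ω)) := by
  simp only [terminalUtility, totalReward_succ]
  rw [entropicUtility_law_succ]
  · simp only [add_assoc]
  · intro _ _ h
    exact congrArg₂ (· + ·) (dependsOn_totalReward M π n h) (dependsOn_reward M π le_rfl h)

/-- Here `w` is a supersolution along `π`, so by the tower property each further step adds at most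
`l`. -/
theorem terminalUtility_le {γ : ℝ} {w : E → ℝ} {l : ℝ} {π : Policy E U}
    (h : ∀ n ω, M.reward (ω n) (π.action n ω) + M.nextUtility γ w (ω n) (π.action n ω) ≤
      w (ω n) + l) (x : E) (n : ℕ) : M.terminalUtility γ w x π n ≤ w x + n * l := by
  induction n with
  | zero => simp [terminalUtility_zero]
  | succ n ih =>
    have h1 := entropicUtility_law_mono M π x γ (dependsOn_totalReward_step M γ w π n)
      (Z' := fun ω => M.totalReward π n ω + w (ω n) + l)
      (fun _ _ h => congrArg (· + l) (dependsOn_totalReward_add M π n w h))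
      (fun ω => by linarith [h n ω])
    rw [entropicUtility_law_add_const M π x γ (dependsOn_totalReward_add M π n w),
      ← terminalUtility_succ] at h1
    simp only [terminalUtility] at ih h1 ⊢
    push_cast
    linarith

theorem le_terminalUtility {γ : ℝ} {w : E → ℝ} {l : ℝ} {π : Policy E U}
    (h : ∀ n ω, w (ω n) + l ≤
      M.reward (ω n) (π.action n ω) + M.nextUtility γ w (ω n) (π.action n ω)) (x : E) (n : ℕ) :
    w x + n * l ≤ M.terminalUtility γ w x π n := by
  induction n with
  | zero => simp [terminalUtility_zero]
  | succ n ih =>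
    have h1 := entropicUtility_law_mono M π x γ
      (Z := fun ω => M.totalReward π n ω + w (ω n) + l)
      (fun _ _ h => congrArg (· + l) (dependsOn_totalReward_add M π n w h))
      (dependsOn_totalReward_step M γ w π n) (fun ω => by linarith [h n ω])
    rw [entropicUtility_law_add_const M π x γ (dependsOn_totalReward_add M π n w),
      ← terminalUtility_succ] at h1
    simp only [terminalUtility] at ih h1 ⊢
    push_cast
    linarith

/-- The bound is uniform in `n`, so the terminal reward is invisible in the long-run average. -/
theorem abs_entropicReward_sub_terminalUtility_le (γ : ℝ) {w : E → ℝ} {W : ℝ}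
    (hW : ∀ x, |w x| ≤ W) (x : E) (π : Policy E U) (n : ℕ) :
    |M.entropicReward γ x π n - M.terminalUtility γ w x π n| ≤ W := by
  have hd := dependsOn_totalReward M π n
  have hk : ∀ k : ℝ, DependsOn (fun ω => M.totalReward π n ω + k) (Set.Iic n) := fun k _ _ h =>
    congrArg (· + k) (hd h)
  have h1 := entropicUtility_law_mono M π x γ (dependsOn_totalReward_add M π n w) (hk W)
    fun ω => by linarith [(abs_le.1 (hW (ω n))).2]
  have h2 := entropicUtility_law_mono M π x γ (hk (-W)) (dependsOn_totalReward_add M π n w)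
    fun ω => by linarith [(abs_le.1 (hW (ω n))).1]
  rw [entropicUtility_law_add_const M π x γ hd] at h1 h2
  rw [entropicReward_eq, terminalUtility, abs_le]
  constructor <;> linarith

end Law

/-! ### Verification: solutions of the equations give the criterion. -/

section Criterion

theorem tendsto_coe_add_div (l D : ℝ) :
    Tendsto (fun n : ℕ => ((l + D / n : ℝ) : EReal)) atTop (𝓝 (l : EReal)) := by
  refine (continuous_coe_real_ereal.tendsto l).comp ?_
  simpa using (tendsto_const_div_atTop_nhds_zero_nat D).const_add l

theorem liminf_coe_le {s : ℕ → ℝ} {l D : ℝ} (h : ∀ n : ℕ, s n ≤ n * l + D) :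
    liminf (fun n : ℕ => ((1 / (n : ℝ) * s n : ℝ) : EReal)) atTop ≤ l := by
  rw [← (tendsto_coe_add_div l D).liminf_eq]
  refine liminf_le_liminf ?_
  filter_upwards [eventually_gt_atTop 0] with n hn
  have hn' : (0 : ℝ) < n := Nat.cast_pos.2 hn
  refine EReal.coe_le_coe_iff.2 ?_
  rw [one_div_mul_eq_div, div_le_iff₀ hn', add_mul, div_mul_cancel₀ _ hn'.ne']
  linarith [h n]

theorem le_liminf_coe {s : ℕ → ℝ} {l D : ℝ} (h : ∀ n : ℕ, n * l + D ≤ s n) :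
    l ≤ liminf (fun n : ℕ => ((1 / (n : ℝ) * s n : ℝ) : EReal)) atTop := by
  rw [← (tendsto_coe_add_div l D).liminf_eq]
  refine liminf_le_liminf ?_
  filter_upwards [eventually_gt_atTop 0] with n hn
  have hn' : (0 : ℝ) < n := Nat.cast_pos.2 hn
  refine EReal.coe_le_coe_iff.2 ?_
  rw [one_div_mul_eq_div, le_div_iff₀ hn', add_mul, div_mul_cancel₀ _ hn'.ne']
  linarith [h n]

variable [Fintype E] [MeasurableSpace E] [DiscreteMeasurableSpace E] {M : MDP E U}

theorem criterion_le {γ : ℝ} {w : E → ℝ} {l : ℝ} {π : Policy E U}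
    (h : ∀ n ω, M.reward (ω n) (π.action n ω) + M.nextUtility γ w (ω n) (π.action n ω) ≤
      w (ω n) + l) (x : E) : M.criterion γ x π ≤ l := by
  obtain ⟨W, hW⟩ := (Set.finite_range fun x => |w x|).bddAbove
  refine liminf_coe_le (D := W + w x) fun n => ?_
  linarith [terminalUtility_le M h x n,
    (abs_le.1 (abs_entropicReward_sub_terminalUtility_le M γ (fun x => hW ⟨x, rfl⟩) x π n)).2]

theorem le_criterion {γ : ℝ} {w : E → ℝ} {l : ℝ} {π : Policy E U}
    (h : ∀ n ω, w (ω n) + l ≤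
      M.reward (ω n) (π.action n ω) + M.nextUtility γ w (ω n) (π.action n ω)) (x : E) :
    l ≤ M.criterion γ x π := by
  obtain ⟨W, hW⟩ := (Set.finite_range fun x => |w x|).bddAbove
  refine le_liminf_coe (D := w x - W) fun n => ?_
  linarith [le_terminalUtility M h x n,
    (abs_le.1 (abs_entropicReward_sub_terminalUtility_le M γ (fun x => hW ⟨x, rfl⟩) x π n)).1]

theorem SolvesPoisson.criterion_eq {u : E → U} {γ : ℝ} {w : E → ℝ} {l : ℝ}
    (h : M.SolvesPoisson u γ w l) (x : E) : M.criterion γ x (stationary u) = l := by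
  have h' : ∀ (n : ℕ) (ω : ℕ → E), M.reward (ω n) ((stationary u).action n ω) +
      M.nextUtility γ w (ω n) ((stationary u).action n ω) = w (ω n) + l := fun n ω => by
    change M.reward (ω n) (u (ω n)) + M.nextUtility γ w (ω n) (u (ω n)) = _
    linarith [h (ω n)]
  exact le_antisymm (criterion_le (fun n ω => (h' n ω).le) x)
    (le_criterion (fun n ω => (h' n ω).ge) x)

/-- The Bellman inequality holds for every action, hence along history-dependent policies too; a
selector of maximizers attains the bound. -/
theorem SolvesBellman.optimalValue_eq {γ : ℝ} {w : E → ℝ} {l : ℝ}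
    (h : M.SolvesBellman γ w l) (x : E) : M.optimalValue γ x = l := by
  refine le_antisymm (iSup_le fun π => criterion_le (w := w) (fun n ω => ?_) x) ?_
  · have := (h (ω n)).2 ⟨π.action n ω, rfl⟩
    dsimp only at this
    linarith
  · obtain ⟨u, hu⟩ := exists_solvesPoisson_of_solvesBellman h
    rw [← hu.criterion_eq x]
    exact le_iSup (M.criterion γ x) (stationary u)

end Criterion

end MDP

/-! ### Perron eigenvalues and analyticity in the parameter. -/

namespace MDP

open scoped ContDiff

variable {E U : Type*} [Fintype E]

/-- The exponentially tilted transition operator of the stationary policy `u`. -/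
noncomputable def tiltedOp (M : MDP E U) (u : E → U) (γ : ℝ) (f : E → ℝ) (x : E) : ℝ :=
  Real.exp (γ * M.reward x (u x)) * ∑ y, f y * (M.trans (u x) x y).toReal

/-- `f` is a positive eigenvector of the tilted operator, with eigenvalue `r`. -/
structure IsPosEigen (M : MDP E U) (u : E → U) (γ : ℝ) (f : E → ℝ) (r : ℝ) : Prop where
  pos : ∀ x, 0 < f x
  eq : ∀ x, M.tiltedOp u γ f x = r * f x

variable {M : MDP E U} {u : E → U} {γ r : ℝ} {f : E → ℝ}

theorem tiltedOp_mono {g h : E → ℝ} (hgh : ∀ x, g x ≤ h x) (x : E) :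
    M.tiltedOp u γ g x ≤ M.tiltedOp u γ h x :=
  mul_le_mul_of_nonneg_left (PMF.sum_mul_toReal_le _ hgh) (Real.exp_pos _).le

theorem tiltedOp_smul (t : ℝ) (h : E → ℝ) (x : E) :
    M.tiltedOp u γ (fun y => t * h y) x = t * M.tiltedOp u γ h x := by
  simp only [tiltedOp, mul_assoc, ← Finset.mul_sum]
  ring

theorem tiltedOp_sub (g h : E → ℝ) (x : E) :
    M.tiltedOp u γ (fun y => g y - h y) x = M.tiltedOp u γ g x - M.tiltedOp u γ h x := by
  simp only [tiltedOp, sub_mul, Finset.sum_sub_distrib, mul_sub]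

theorem SolvesPoisson.isPosEigen {w : E → ℝ} {l : ℝ} (hγ : γ ≠ 0) (h : M.SolvesPoisson u γ w l) :
    M.IsPosEigen u γ (fun x => Real.exp (γ * w x)) (Real.exp (γ * l)) where
  pos _ := Real.exp_pos _
  eq x := by
    rw [tiltedOp, ← exp_mul_nextUtility M hγ, ← Real.exp_add, ← Real.exp_add, h x]
    congr 1
    ring

theorem isPosEigen_zero : M.IsPosEigen u 0 (fun _ => 1) 1 where
  pos _ := one_pos
  eq x := by simp [tiltedOp, PMF.sum_toReal]

namespace IsPosEigen

theorem eigenvalue_pos [Nonempty E] (h : M.IsPosEigen u γ f r) : 0 < r := by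
  have x := Classical.arbitrary E
  refine pos_of_mul_pos_left ?_ (h.pos x).le
  rw [← h.eq x]
  exact mul_pos (Real.exp_pos _) (PMF.sum_mul_toReal_pos _ h.pos)

theorem solvesPoisson [Nonempty E] (hγ : γ ≠ 0) (h : M.IsPosEigen u γ f r) :
    M.SolvesPoisson u γ (fun x => 1 / γ * Real.log (f x)) (1 / γ * Real.log r) := fun x => by
  have hexp : ∀ y, Real.exp (γ * (1 / γ * Real.log (f y))) = f y := fun y => by
    rw [← mul_assoc, mul_one_div_cancel hγ, one_mul, Real.exp_log (h.pos y)]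
  refine mul_left_cancel₀ hγ (Real.exp_injective ?_)
  rw [hexp, mul_add, Real.exp_add, exp_mul_nextUtility M hγ, mul_sub, Real.exp_sub, ← mul_assoc,
    mul_one_div_cancel hγ, one_mul, Real.exp_log h.eigenvalue_pos, div_mul_eq_mul_div,
    eq_div_iff h.eigenvalue_pos.ne', mul_comm, ← h.eq x]
  simp only [hexp, tiltedOp]

/-- A zero of `g` at a point means that every `n`-step law from there misses the support of `g`. By
comparability at `n = N`, this does not depend on the point. -/
theorem eq_zero_of_nonneg [Nonempty E] {N : ℕ} {K : ℝ} (hM : M.RatioBound N K)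
    (h : M.IsPosEigen u γ f r) {g : E → ℝ} (hg : ∀ x, 0 ≤ g x)
    (hgr : ∀ x, M.tiltedOp u γ g x = r * g x) {x₀ : E} (hx₀ : g x₀ = 0) (x : E) : g x = 0 := by
  have hr := h.eigenvalue_pos
  have hnn : ∀ z y, 0 ≤ g y * (M.trans (u z) z y).toReal := fun z y =>
    mul_nonneg (hg y) ENNReal.toReal_nonneg
  have key : ∀ z, g z = 0 ↔ ∑ y, g y * (M.trans (u z) z y).toReal = 0 := fun z => by
    have := hgr z
    rw [tiltedOp] at this
    constructor
    · intro h0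
      rw [h0, mul_zero] at this
      exact (mul_eq_zero.1 this).resolve_left (Real.exp_pos _).ne'
    · intro h0
      rw [h0, mul_zero] at this
      exact (mul_eq_zero.1 this.symm).resolve_left hr.ne'
  have hn : ∀ n x, g x = 0 ↔ ∑ y, g y * (M.nStep (fun _ => u) n x y).toReal = 0 := by
    classical
    intro n x
    induction n with
    | zero =>
      rw [Finset.sum_eq_single x]
      · simp [nStep]
      · intro y _ hy; simp [nStep, hy]
      · simp
    | succ n ih =>
      rw [ih, sum_mul_nStep_succ, Finset.sum_eq_zero_iff_of_nonneg fun y _ =>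
        mul_nonneg (hg y) ENNReal.toReal_nonneg, Finset.sum_eq_zero_iff_of_nonneg fun y _ =>
        mul_nonneg (Finset.sum_nonneg fun z _ => hnn y z) ENNReal.toReal_nonneg]
      refine forall₂_congr fun y _ => ?_
      rw [mul_eq_zero, mul_eq_zero, key]
  rw [hn N, Finset.sum_eq_zero_iff_of_nonneg fun y _ =>
        mul_nonneg (hg y) ENNReal.toReal_nonneg] at hx₀ ⊢
  intro y hy
  refine mul_eq_zero.2 ((mul_eq_zero.1 (hx₀ y hy)).imp id fun h0 => ?_)
  have := hM x x₀ y fun _ => u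
  rw [h0, mul_zero] at this
  exact le_antisymm this ENNReal.toReal_nonneg

/-- The eigenvalue of a positive eigenvector is simple. -/
theorem simple [Nonempty E] {N : ℕ} {K : ℝ} (hM : M.RatioBound N K)
    (h : M.IsPosEigen u γ f r) {g : E → ℝ} {s : ℝ}
    (hg : ∀ x, M.tiltedOp u γ g x = r * g x + s * f x) (hsum : ∑ x, g x = 0) :
    s = 0 ∧ ∀ x, g x = 0 := by
  have hcancel : ∀ x, g x / f x * f x = g x := fun x => div_mul_cancel₀ _ (h.pos x).ne'
  -- Comparing `g` with multiples of `f` at the extreme ratios forces `s = 0`. Then `g` minus its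
  -- minimal multiple of `f` is a nonnegative eigenvector with a zero, so `g` is proportional to
  -- `f`.
  obtain ⟨i, hi⟩ := Finite.exists_min fun x => g x / f x
  obtain ⟨j, hj⟩ := Finite.exists_max fun x => g x / f x
  have hle : s ≤ 0 := by
    have := tiltedOp_mono (M := M) (u := u) (γ := γ) (g := g) (h := fun y => g j / f j * f y)
      (fun x => by rw [← div_le_iff₀ (h.pos x)]; exact hj x) j
    rw [tiltedOp_smul, hg, h.eq, mul_left_comm, hcancel] at this
    exact nonpos_of_mul_nonpos_left (by linarith) (h.pos j)
  have hge : 0 ≤ s := by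
    have := tiltedOp_mono (M := M) (u := u) (γ := γ) (g := fun y => g i / f i * f y) (h := g)
      (fun x => by rw [← le_div_iff₀ (h.pos x)]; exact hi x) i
    rw [tiltedOp_smul, hg, h.eq, mul_left_comm, hcancel] at this
    exact nonneg_of_mul_nonneg_left (by linarith) (h.pos i)
  have hs : s = 0 := le_antisymm hle hge
  have hz := h.eq_zero_of_nonneg hM (g := fun x => g x - g i / f i * f x)
    (fun x => by rw [sub_nonneg, ← le_div_iff₀ (h.pos x)]; exact hi x)
    (fun x => by rw [tiltedOp_sub, tiltedOp_smul, hg, h.eq, hs]; ring)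
    (x₀ := i) (by rw [hcancel, sub_self])
  have hgf : ∀ x, g x = g i / f i * f x := fun x => sub_eq_zero.1 (hz x)
  refine ⟨hs, fun x => ?_⟩
  have ht : g i / f i = 0 := by
    rw [Finset.sum_congr rfl fun x _ => hgf x, ← Finset.mul_sum] at hsum
    exact (mul_eq_zero.1 hsum).resolve_right
      (Finset.sum_pos (fun x _ => h.pos x) Finset.univ_nonempty).ne'
  rw [hgf x, ht, zero_mul]

/-- The eigenvalue of a positive eigenvector depends analytically on the parameter. -/
theorem exists_analyticAt [Nonempty E] {N : ℕ} {K : ℝ} (hM : M.RatioBound N K)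
    (h : M.IsPosEigen u γ f r) : ∃ ρ : ℝ → ℝ, AnalyticAt ℝ ρ γ ∧ ρ γ = r ∧
      ∀ᶠ γ' in 𝓝 γ, ∃ f', M.IsPosEigen u γ' f' (ρ γ') := by
  -- The eigenvalue equation, bordered by `∑ x, f x` to remove the freedom of scaling `f`.
  set F : ℝ × ((E → ℝ) × ℝ) → (E → ℝ) × ℝ := fun z =>
    (fun x => Real.exp (z.1 * M.reward x (u x)) * ∑ y, z.2.1 y * (M.trans (u x) x y).toReal -
      z.2.2 * z.2.1 x, ∑ x, z.2.1 x)
  set z₀ : ℝ × ((E → ℝ) × ℝ) := (γ, (f, r))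
  have hF : ContDiff ℝ ω F := by
    refine ContDiff.prodMk (contDiff_pi.2 fun x => ?_) ?_ <;> fun_prop
  have hFz : F z₀ = (0, ∑ x, f x) := by
    refine Prod.ext (funext fun x => ?_) rfl
    exact sub_eq_zero.2 (h.eq x)
  have hinj : Function.Injective
      (fderiv ℝ F z₀ ∘L .inr ℝ ℝ ((E → ℝ) × ℝ)) := by
    refine (injective_iff_map_eq_zero _).2 fun ⟨g, s⟩ h0 => ?_
    -- The partial derivative is read off along lines, where `F` is a quadratic polynomial in `t`.
    have hd : HasDerivAt (fun t : ℝ => F (z₀ + t • ((0 : ℝ), (g, s)))) 0 0 := by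
      have := ((hF.differentiable (by simp)) z₀).hasFDerivAt.hasLineDerivAt ((0 : ℝ), (g, s))
      rw [show fderiv ℝ F z₀ ((0 : ℝ), (g, s)) = 0 from h0] at this
      exact this
    have h1 : ∀ x, M.tiltedOp u γ g x = r * g x + s * f x := fun x => by
      have hd1 := hasDerivAt_pi.1 hd.fst x
      have hd2 : HasDerivAt (fun t : ℝ => (M.tiltedOp u γ f x - r * f x) +
          t * (M.tiltedOp u γ g x - (r * g x + s * f x)) - t * t * (s * g x))
          (M.tiltedOp u γ g x - (r * g x + s * f x)) 0 := by
        have := (((hasDerivAt_id (0 : ℝ)).mul_const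
          (M.tiltedOp u γ g x - (r * g x + s * f x))).const_add
          (M.tiltedOp u γ f x - r * f x)).sub
          (((hasDerivAt_id (0 : ℝ)).mul (hasDerivAt_id (0 : ℝ))).mul_const (s * g x))
        exact this.congr_deriv (by simp)
      have heq : (fun t : ℝ => (F (z₀ + t • ((0 : ℝ), (g, s)))).1 x) =
          fun t : ℝ => (M.tiltedOp u γ f x - r * f x) +
          t * (M.tiltedOp u γ g x - (r * g x + s * f x)) - t * t * (s * g x) := by
        funext t
        simp only [F, z₀, tiltedOp, Prod.fst_add, Prod.snd_add, Prod.smul_fst, Prod.smul_snd,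
          Pi.add_apply, Pi.smul_apply, smul_eq_mul, mul_zero, add_zero, add_mul,
          Finset.sum_add_distrib, mul_assoc, ← Finset.mul_sum]
        ring
      rw [heq] at hd1
      have := hd2.unique hd1
      exact sub_eq_zero.1 this
    have h2 : ∑ x, g x = 0 := by
      have hd1 := hd.snd
      have heq : (fun t : ℝ => (F (z₀ + t • ((0 : ℝ), (g, s)))).2) =
          fun t : ℝ => ∑ x, f x + t * ∑ x, g x := by
        funext t
        simp [F, z₀, Finset.sum_add_distrib, Finset.mul_sum]
      rw [heq] at hd1
      have hd2 := ((hasDerivAt_id (0 : ℝ)).mul_const (∑ x, g x)).const_add (∑ x, f x)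
      simpa using hd2.unique hd1
    obtain ⟨hs, hg⟩ := h.simple hM h1 h2
    exact Prod.ext (funext hg) hs
  have hinv : (fderiv ℝ F z₀ ∘L .inr ℝ ℝ ((E → ℝ) × ℝ)).IsInvertible :=
    ⟨(LinearEquiv.ofInjectiveEndo _ hinj).toContinuousLinearEquiv,
      ContinuousLinearMap.ext fun _ => rfl⟩
  have hω : (ω : WithTop ℕ∞) ≠ 0 := by simp
  have hFc : ContDiffAt ℝ ω F z₀ := hF.contDiffAt
  set ψ := hFc.implicitFunction hω hinv
  have hψ : ContDiffAt ℝ ω ψ γ := hFc.contDiffAt_implicitFunction hω hinv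
  have hψγ : ψ γ = (f, r) := hFc.implicitFunction_apply_self hω hinv
  have hev : ∀ᶠ γ' in 𝓝 γ, F (γ', ψ γ') = F z₀ := hFc.eventually_apply_implicitFunction hω hinv
  refine ⟨fun γ' => (ψ γ').2, hψ.snd.analyticAt, by simp only [hψγ], ?_⟩
  have hpos : ∀ᶠ γ' in 𝓝 γ, ∀ x, 0 < (ψ γ').1 x := eventually_all.2 fun x => by
    have hc : ContinuousAt (fun γ' => (ψ γ').1 x) γ :=
      (continuous_apply x).continuousAt.comp (continuous_fst.continuousAt.comp hψ.continuousAt)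
    refine hc.eventually (lt_mem_nhds ?_)
    simp only [hψγ]
    exact h.pos x
  filter_upwards [hev, hpos] with γ' h1 h2
  refine ⟨(ψ γ').1, h2, fun x => ?_⟩
  rw [hFz] at h1
  exact sub_eq_zero.1 (congrFun (congrArg Prod.fst h1) x)

end IsPosEigen

/-- Away from 0, `L` is `log ρ / γ`. At 0, where `ρ = 1`, the quotient extends analytically as a
divided slope. -/
theorem analyticAt_of_solvesPoisson [Nonempty E] {N : ℕ} {K : ℝ} (hM : M.RatioBound N K)
    {L : ℝ → ℝ} (hL : ∀ γ l, (∃ w, M.SolvesPoisson u γ w l) ↔ l = L γ) (hmono : Monotone L)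
    (γ : ℝ) : AnalyticAt ℝ L γ := by
  rcases eq_or_ne γ 0 with rfl | hγ
  · obtain ⟨ρ, hρ, hρ0, hev⟩ := (isPosEigen_zero (M := M) (u := u)).exists_analyticAt hM
    have hlog : AnalyticAt ℝ (fun γ => Real.log (ρ γ)) 0 := by
      refine AnalyticAt.log hρ ?_
      rw [hρ0]; exact one_pos
    obtain ⟨p, hp⟩ := hlog
    have hk : AnalyticAt ℝ (dslope (fun γ => Real.log (ρ γ)) 0) 0 :=
      hp.has_fpower_series_dslope_fslope.analyticAt
    set k := dslope (fun γ => Real.log (ρ γ)) 0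
    have hne : ∀ᶠ γ in 𝓝[≠] 0, L γ = k γ := by
      filter_upwards [hev.filter_mono nhdsWithin_le_nhds, self_mem_nhdsWithin] with γ hγ h0
      obtain ⟨f, hf⟩ := hγ
      rw [← (hL γ _).1 ⟨_, hf.solvesPoisson h0⟩, show k γ = slope _ 0 γ from dslope_of_ne _ h0,
        slope_def_field, hρ0]
      simp only [Real.log_one, sub_zero]
      exact one_div_mul_eq_div _ _
    -- Continuity of `L` at 0 is not yet known; monotonicity squeezes `L 0` between the one-sided
    -- limits, both equal to `k 0`.
    have hL0 : L 0 = k 0 := by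
      refine le_antisymm ?_ ?_
      · refine ge_of_tendsto (hk.continuousAt.tendsto.mono_left
          (nhdsWithin_le_nhds (s := Set.Ioi 0))) ?_
        filter_upwards [hne.filter_mono (nhdsWithin_mono _ fun x hx => ne_of_gt hx),
          self_mem_nhdsWithin] with γ h1 h2
        rw [← h1]
        exact hmono (le_of_lt h2)
      · refine le_of_tendsto (hk.continuousAt.tendsto.mono_left
          (nhdsWithin_le_nhds (s := Set.Iio 0))) ?_
        filter_upwards [hne.filter_mono (nhdsWithin_mono _ fun x hx => ne_of_lt hx),
          self_mem_nhdsWithin] with γ h1 h2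
        rw [← h1]
        exact hmono (le_of_lt h2)
    refine hk.congr ?_
    have := (eventually_nhdsWithin_iff.1 hne)
    filter_upwards [this] with γ h
    rcases eq_or_ne γ 0 with rfl | h0
    · exact hL0.symm
    · exact (h h0).symm
  · obtain ⟨w, hw⟩ := (hL γ _).2 rfl
    have hf := hw.isPosEigen hγ
    obtain ⟨ρ, hρ, hρ0, hev⟩ := hf.exists_analyticAt hM
    have hlog : AnalyticAt ℝ (fun γ => Real.log (ρ γ)) γ := by
      refine AnalyticAt.log hρ ?_
      rw [hρ0]; exact Real.exp_pos _
    refine (((analyticAt_const (v := (1 : ℝ))).div analyticAt_id hγ).mul hlog).congr ?_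
    filter_upwards [hev, isOpen_ne.mem_nhds hγ] with γ' ⟨f, hf'⟩ h0
    exact (hL γ' _).1 ⟨_, hf'.solvesPoisson h0⟩

end MDP

/-! ### Maxima of finitely many analytic functions. -/

/-- The set where a real analytic function attains the maximum of finitely many real analytic
functions is a countable union of closed intervals. -/
theorem exists_countable_intervals_of_analytic {ι : Type*} [Finite ι] {L : ι → ℝ → ℝ}
    (hL : ∀ i, AnalyticOnNhd ℝ (L i) Set.univ) (i : ι) :
    ∃ S : Set (Set ℝ), S.Countable ∧ (∀ I ∈ S, I.Nonempty ∧ IsClosed I ∧ I.OrdConnected) ∧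
      {γ | ∀ j, L j γ ≤ L i γ} = ⋃₀ S := by
  set G : Set ℝ := {γ | ∀ j, L j γ ≤ L i γ}
  have hc : ∀ j, Continuous (L j) := fun j => continuousOn_univ.1 (hL j).continuousOn
  have hG : IsClosed G := by
    simp only [G, Set.ofPred_forall]
    exact isClosed_iInter fun j => isClosed_le (hc j) (hc i)
  set J : Set ι := {j | ¬ ∀ γ, L j γ = L i γ}
  set Z : Set ℝ := ⋃ j ∈ J, {γ | L j γ = L i γ}
  -- By the identity theorem each coincidence set is closed and discrete, hence countable in `ℝ`.
  have hZ : Z.Countable := by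
    refine J.to_countable.biUnion fun j hj => ?_
    have hd : {γ | L j γ = L i γ}ᶜ ∈ codiscrete ℝ := by
      rcases (hL j).eqOn_or_eventually_ne_of_preconnected (hL i) isPreconnected_univ with h | h
      · exact absurd (fun γ => h (Set.mem_univ γ)) hj
      · exact h
    exact (isClosed_eq (hc j) (hc i)).isLindelof.countable_of_isDiscrete
      (compl_mem_codiscrete_iff.1 hd).2
  -- Singletons cover `Z ∩ G`. Every other point of `G` is interior, so its component contains a
  -- rational.
  refine ⟨(fun γ => {γ}) '' (Z ∩ G) ∪
    (fun q : ℚ => connectedComponentIn G q) '' {q : ℚ | (q : ℝ) ∈ G}, ?_, ?_, ?_⟩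
  · exact ((hZ.mono Set.inter_subset_left).image _).union ((Set.to_countable _).image _)
  · rintro I (⟨γ, -, rfl⟩ | ⟨q, hq, rfl⟩)
    · exact ⟨Set.singleton_nonempty γ, isClosed_singleton, Set.ordConnected_singleton⟩
    · refine ⟨connectedComponentIn_nonempty_iff.2 hq, ?_,
        isPreconnected_connectedComponentIn.ordConnected⟩
      exact isClosed_of_closure_subset
        (isPreconnected_connectedComponentIn.closure.subset_connectedComponentIn
          (subset_closure (mem_connectedComponentIn hq))
          (closure_minimal (connectedComponentIn_subset G q) hG))
  · refine Set.Subset.antisymm (fun γ hγ => ?_) ?_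
    · by_cases hγZ : γ ∈ Z
      · exact ⟨{γ}, Or.inl ⟨γ, ⟨hγZ, hγ⟩, rfl⟩, rfl⟩
      · have hnhds : G ∈ 𝓝 γ := by
          refine eventually_all.2 fun j => ?_
          by_cases hj : ∀ γ, L j γ = L i γ
          · exact Eventually.of_forall fun γ => (hj γ).le
          · have hlt : L j γ < L i γ := (hγ j).lt_of_ne fun h => hγZ (Set.mem_biUnion hj h)
            exact ((hc j).continuousAt.eventually_lt (hc i).continuousAt hlt).mono
              fun _ h => h.le
        obtain ⟨a, b, hab, hsub⟩ := mem_nhds_iff_exists_Ioo_subset.1 hnhds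
        obtain ⟨q, hq1, hq2⟩ := exists_rat_btwn hab.1
        have hq : (q : ℝ) ∈ Set.Ioo a b := ⟨hq1, hq2.trans hab.2⟩
        exact ⟨_, Or.inr ⟨q, hsub hq, rfl⟩,
          isPreconnected_Ioo.subset_connectedComponentIn hq hsub hab⟩
    · rintro γ ⟨I, ⟨γ', h, rfl⟩ | ⟨q, hq, rfl⟩, hγ⟩
      · rw [Set.mem_singleton_iff.1 hγ]
        exact h.2
      · exact connectedComponentIn_subset _ _ hγ

/-! ### Optimality expressed through the eigenvalues. -/

theorem mainTheorem3 {E U : Type*} [Fintype E] [Nonempty E] [MeasurableSpace E]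
    [DiscreteMeasurableSpace E] [Finite U] [Nonempty U] (M : MDP E U)
    (hA1 : M.OneStepMixing) (hA2 : M.TransitionEquivalence) :
    -- `lamPol u γ` and `lam γ` are the unique constants in the Poisson and Bellman equations
    ∃ (lamPol : (E → U) → ℝ → ℝ) (lam : ℝ → ℝ),
      -- (1)
      (∀ u γ l, (∃ w, M.SolvesPoisson u γ w l) ↔ l = lamPol u γ) ∧
      (∀ γ l, (∃ w, M.SolvesBellman γ w l) ↔ l = lam γ) ∧
      -- (2)
      (∀ u, Continuous (lamPol u) ∧ (∃ B, ∀ γ, |lamPol u γ| ≤ B) ∧ Monotone (lamPol u) ∧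
        AnalyticOnNhd ℝ (lamPol u) Set.univ) ∧
      -- (3)
      (∀ γ, IsGreatest (Set.range fun u => lamPol u γ) (lam γ) ∧
        ∀ x, M.optimalValue γ x = (lam γ : EReal)) ∧
      -- (4)
      (∀ γ u, (∀ v, lamPol v γ ≤ lamPol u γ) → u ∈ M.optimalPolicies γ) ∧
      -- (5)
      (∀ u, IsClosed (M.optimalParams u) ∧
        ∃ S : Set (Set ℝ), S.Countable ∧
          (∀ I ∈ S, I.Nonempty ∧ IsClosed I ∧ I.OrdConnected) ∧
          M.optimalParams u = ⋃₀ S) ∧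
      -- (6), for `γ → ∞`
      (∃ lamTop : (E → U) → ℝ,
        (∀ u, Tendsto (lamPol u) atTop (𝓝 (lamTop u)) ∧ ∀ γ, lamPol u γ ≤ lamTop u) ∧
        ∀ u₀, (∀ u, u ≠ u₀ → lamTop u < lamTop u₀) →
          ∃ γ₀ : ℝ, ∀ γ, γ₀ ≤ γ → M.optimalPolicies γ = {u₀}) ∧
      -- (6), for `γ → -∞`
      (∃ lamBot : (E → U) → ℝ,
        (∀ u, Tendsto (lamPol u) atBot (𝓝 (lamBot u)) ∧ ∀ γ, lamBot u ≤ lamPol u γ) ∧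
        ∀ u₀, (∀ u, u ≠ u₀ → lamBot u < lamBot u₀) →
          ∃ γ₀ : ℝ, ∀ γ, γ ≤ γ₀ → M.optimalPolicies γ = {u₀}) := by
  obtain ⟨δ, hδ, h1⟩ := hA1.exists_mixingBound
  obtain ⟨N, K, h2⟩ := hA2.exists_ratioBound
  obtain ⟨C, hC0, hC⟩ := M.exists_forall_abs_reward_le
  choose w lam hw using MDP.exists_solvesBellman hδ h1 h2
  have hex : ∀ (u : E → U) γ, ∃ l w, M.SolvesPoisson u γ w l := fun u γ => by
    obtain ⟨w, l, h⟩ := MDP.exists_solvesBellman hδ (h1.restrict u) (h2.restrict u) γ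
    exact ⟨l, w, (M.solvesPoisson_iff_restrict u γ w l).2 h⟩
  choose lamPol wP hwP using hex
  have hP : ∀ u γ l, (∃ w, M.SolvesPoisson u γ w l) ↔ l = lamPol u γ := fun u γ l => by
    refine ⟨fun ⟨w, h⟩ => ?_, fun h => h ▸ ⟨_, hwP u γ⟩⟩
    exact MDP.solvesBellman_unique _ ((M.solvesPoisson_iff_restrict u γ w l).1 h)
      ((M.solvesPoisson_iff_restrict u γ _ _).1 (hwP u γ))
  have hB : ∀ γ l, (∃ w, M.SolvesBellman γ w l) ↔ l = lam γ := fun γ l =>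
    ⟨fun ⟨_, h⟩ => MDP.solvesBellman_unique _ h (hw γ), fun h => h ▸ ⟨_, hw γ⟩⟩
  have hbd : ∀ u γ, |lamPol u γ| ≤ C := fun u γ =>
    MDP.abs_le_of_solvesBellman (M.restrict u) (fun x _ => hC x (u x))
      ((M.solvesPoisson_iff_restrict u γ _ _).1 (hwP u γ))
  have hmono : ∀ u, Monotone (lamPol u) := fun u γ γ' h =>
    MDP.solvesBellman_mono_param (M.restrict u) h
      ((M.solvesPoisson_iff_restrict u γ _ _).1 (hwP u γ))
      ((M.solvesPoisson_iff_restrict u γ' _ _).1 (hwP u γ'))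
  have han : ∀ u, AnalyticOnNhd ℝ (lamPol u) Set.univ := fun u γ _ =>
    MDP.analyticAt_of_solvesPoisson h2 (hP u) (hmono u) γ
  have hcont : ∀ u, Continuous (lamPol u) := fun u => continuousOn_univ.1 (han u).continuousOn
  have hle : ∀ u γ, lamPol u γ ≤ lam γ := fun u γ => (hwP u γ).le_of_solvesBellman (hw γ)
  have hmax : ∀ γ, ∃ u, lamPol u γ = lam γ := fun γ => by
    obtain ⟨u, hu⟩ := MDP.exists_solvesPoisson_of_solvesBellman (hw γ)
    exact ⟨u, ((hP u γ _).1 ⟨_, hu⟩).symm⟩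
  have hopt : ∀ γ u, u ∈ M.optimalPolicies γ ↔ ∀ v, lamPol v γ ≤ lamPol u γ := fun γ u => by
    have h : u ∈ M.optimalPolicies γ ↔ lamPol u γ = lam γ := by
      simp only [MDP.optimalPolicies, Set.mem_ofPred_eq, (hwP u γ).criterion_eq,
        (hw γ).optimalValue_eq, EReal.coe_eq_coe_iff, forall_const]
    rw [h]
    refine ⟨fun h v => h ▸ hle v γ, fun h => (hle u γ).antisymm ?_⟩
    obtain ⟨v, hv⟩ := hmax γ
    exact hv ▸ h v
  have hset : ∀ u, M.optimalParams u = {γ | ∀ v, lamPol v γ ≤ lamPol u γ} := fun u =>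
    Set.ext fun γ => hopt γ u
  -- Stated for any filter so as to serve both `atTop` and `atBot`; with finitely many policies, all
  -- the strict inequalities hold eventually at once.
  have huniq : ∀ {F : Filter ℝ} {lim : (E → U) → ℝ} {u₀ : E → U},
      (∀ u, Tendsto (lamPol u) F (𝓝 (lim u))) → (∀ u, u ≠ u₀ → lim u < lim u₀) →
      ∀ᶠ γ in F, M.optimalPolicies γ = {u₀} := by
    intro F lim u₀ hlim hu₀
    have hev : ∀ᶠ γ in F, ∀ u, u ≠ u₀ → lamPol u γ < lamPol u₀ γ :=
      eventually_all.2 fun u => by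
        by_cases hu : u = u₀
        · exact Eventually.of_forall fun _ h => absurd hu h
        · exact ((hlim u).eventually_lt (hlim u₀) (hu₀ u hu)).mono fun _ h _ => h
    filter_upwards [hev] with γ hγ
    ext u
    rw [hopt, Set.mem_singleton_iff]
    refine ⟨fun h => by_contra fun hu => absurd (h u₀) (not_le.2 (hγ u hu)), ?_⟩
    rintro rfl v
    rcases eq_or_ne v u with rfl | hv
    · exact le_rfl
    · exact (hγ v hv).le
  have hba : ∀ u, BddAbove (Set.range (lamPol u)) := fun u =>
    ⟨C, by rintro _ ⟨γ, rfl⟩; exact (abs_le.1 (hbd u γ)).2⟩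
  have hbb : ∀ u, BddBelow (Set.range (lamPol u)) := fun u =>
    ⟨-C, by rintro _ ⟨γ, rfl⟩; exact (abs_le.1 (hbd u γ)).1⟩
  have htop : ∀ u, Tendsto (lamPol u) atTop (𝓝 (⨆ γ, lamPol u γ)) := fun u =>
    tendsto_atTop_ciSup (hmono u) (hba u)
  have hbot : ∀ u, Tendsto (lamPol u) atBot (𝓝 (⨅ γ, lamPol u γ)) := fun u =>
    tendsto_atBot_ciInf (hmono u) (hbb u)
  refine ⟨lamPol, lam, hP, hB, fun u => ⟨hcont u, ⟨C, hbd u⟩, hmono u, han u⟩,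
    fun γ => ⟨⟨hmax γ, ?_⟩, (hw γ).optimalValue_eq⟩, fun γ u h => (hopt γ u).2 h,
    fun u => ⟨?_, ?_⟩,
    ⟨_, fun u => ⟨htop u, le_ciSup (hba u)⟩, fun u₀ h => eventually_atTop.1 (huniq htop h)⟩,
    ⟨_, fun u => ⟨hbot u, ciInf_le (hbb u)⟩, fun u₀ h => eventually_atBot.1 (huniq hbot h)⟩⟩
  · rintro _ ⟨u, rfl⟩
    exact hle u γ
  · simp only [hset, Set.ofPred_forall]
    exact isClosed_iInter fun v => isClosed_le (hcont v) (hcont u)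
  · rw [hset]
    exact exists_countable_intervals_of_analytic han u
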